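/- \textbf{Setting.} Let $d\ge 1$, $\mu\in\mathbb{R}^d$ and $\pi_{\mathsf D}=\mathcal N(\mu,I_d)$. For $t\ge 0$ put $m_t=e^{-t}$ and $\sigma_t=\sqrt{1-e^{-2t}}$. For $t>0$ let $p_t$ be the density of the law of $X_t$, where $(X_t)$ is the Ornstein--Uhlenbeck process $\mathrm dX_t=-X_t\,\mathrm dt+\sqrt2\,\mathrm dB_t$, $X_0\sim\pi_{\mathsf D}$; thus $X_t$ has the law of $m_tX_0+\sigma_tZ$ with $Z\sim\mathcal N(0,I_d)$ independent of $X_0$. Let $s(t,\theta,x)=-x+m_t\theta$, let $\gamma\in(0,1)$, $K\in\mathbb{N}_0$ and $T=(K+1)\gamma$, and let $\theta^*$ be a minimiser over $\theta\in\mathbb{R}^d$ of $$U(\theta)=\int_0^T\frac{\sigma_t^2}{T}\int_{\mathbb{R}^d}|\nabla\log p_t(x)-s(t,\theta,x)|^2\,p_t(x)\,\mathrm dx\,\mathrm dt .$$ Below, $\tau\sim\mathrm{Uniform}([0,T])$, $X_0\sim\pi_{\mathsf D}$ and $Z\sim\mathcal N(0,I_d)$ are independent. \emph{SGLD.} Put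 $$H(\theta,(t,x_0,z))=2\sigma_t^2m_t\left(\sigma_t^{-1}z-m_tx_0-\sigma_tz+m_t\theta\right),$$ and let $$\theta_0^\lambda=\theta_0,\qquad \theta^\lambda_{n+1}=\theta^\lambda_n-\lambda H(\theta^\lambda_n,\mathbf X_{n+1})+\sqrt{2\lambda/\beta}\;\xi_{n+1},\qquad n\in\mathbb{N}_0,$$ where $\mathbb E|\theta_0|^2<\infty$, $(\xi_n)$ is i.i.d.\ $\mathcal N(0,I_d)$, $(\mathbf X_n)$ is i.i.d.\ with the law of $(\tau,X_0,Z)$, and $\theta_0$, $(\xi_n)$, $(\mathbf X_n)$ are independent. Here $\beta>0$ and $$0<\lambda\le\min\left\{\frac{\mathbb E[\sigma_\tau^2m_\tau^2]}{4\,\mathbb E[\sigma_\tau^4m_\tau^4]},\ \frac1{2\,\mathbb E[\sigma_\tau^2m_\tau^2]}\right\}.$$ \emph{Sampling.} Fix $n\in\mathbb{N}_0$ and let $\hat\theta=\theta_n^\lambda$. The Euler--Maruyama scheme is $$Y_{k+1}=Y_k+\gamma\left(Y_k+2\,s(T-k\gamma,\hat\theta,Y_k)\right)+\sqrt{2\gamma}\,\bar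 Z_{k+1},\quad k=0,\dots,K,\qquad Y_0\sim\mathcal N(0,I_d),$$ with $(\bar Z_k)$ i.i.d.\ $\mathcal N(0,I_d)$ independent of $Y_0$; $(Y_0,(\bar Z_k))$ lives on a second probability space and all expectations and laws are taken on the product space, so that it is independent of $(\theta_0,(\xi_n),(\mathbf X_n))$. The output of the diffusion model is $Y_{K+1}$. Let $C_1=1/\mathbb E[\sigma_\tau^2m_\tau^2]$, let $$G=\mathbb E\left[\sigma_\tau^4m_\tau^2\left(\sigma_\tau^{-1}|Z|+m_\tau|X_0|+\sigma_\tau|Z|+m_\tau|\theta^*|\right)^2\right],$$ and let $C_2=4G/\mathbb E[\sigma_\tau^2m_\tau^2]$ and $c=\sqrt{4/3}+2\sqrt{33}$. \textbf{Theorem.} In this setting, $$\begin{aligned}W_2(\mathcal L(Y_{K+1}),\pi_{\mathsf D})\le{}&2e^{-T}\left(\sqrt{\mathbb E|X_0|^2}+\sqrt{3d/2}\right)\\&+c\left(e^{-n\lambda\mathbb E[\sigma_\tau^2m_\tau^2]}\sqrt{\mathbb E|\theta_0-\theta^*|^2}+\sqrt{dC_1/\beta}+\sqrt{\lambda C_2}\right)+\gamma\left(\sqrt{18d}+\sqrt{132|\theta^*|^2}\right).\end{aligned}$$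 Moreover, for every $\delta>0$, if $T>T_\delta$, $\beta\ge\beta_\delta$, $\lambda\le\lambda_\delta$, $n\ge n_\delta$ and $\gamma<\gamma_\delta$, where $$T_\delta=\ln\frac{8\left(\sqrt{\mathbb E|X_0|^2}+\sqrt{3d/2}\right)}{\delta},\qquad \beta_\delta=\frac{144\,d\,c^2}{\delta^2\,\mathbb E[\sigma_\tau^2m_\tau^2]},$$ $$\lambda_\delta=\min\left\{\frac{\mathbb E[\sigma_\tau^2m_\tau^2]}{4\mathbb E[\sigma_\tau^4m_\tau^4]},\ \frac1{2\mathbb E[\sigma_\tau^2m_\tau^2]},\ \frac{\delta^2\,\mathbb E[\sigma_\tau^2m_\tau^2]}{576\,c^2\,G}\right\},$$ $$n_\delta=\frac{1}{\lambda\,\mathbb E[\sigma_\tau^2m_\tau^2]}\ln\frac{12\,c\sqrt{\mathbb E|\theta_0-\theta^*|^2}}{\delta},\qquad \gamma_\delta=\min\left\{\frac{\delta}{4\sqrt{18d+132|\theta^*|^2}},\ \frac12\right\}$$ (with $\ln 0=-\infty$), then $W_2(\mathcal L(Y_{K+1}),\pi_{\mathsf D})<\delta$. -/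

import Mathlib

open MeasureTheory ProbabilityTheory

open scoped ENNReal

noncomputable section

namespace ScoreDiffusion

/-- The Euclidean space `ℝ^d`. -/
abbrev E (d : ℕ) : Type := EuclideanSpace ℝ (Fin d)

/-- The set of couplings of `μ` and `ν`: the probability measures on the product with marginals
`μ` and `ν`. -/
def couplings {d : ℕ} (μ ν : Measure (E d)) : Set (Measure (E d × E d)) :=
  {ζ | IsProbabilityMeasure ζ ∧ ζ.fst = μ ∧ ζ.snd = ν}

/-- The Wasserstein distance of order two (with values in `[0, ∞]`). -/
def W2 {d : ℕ} (μ ν : Measure (E d)) : ℝ≥0∞ :=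
  (⨅ ζ ∈ couplings μ ν, ∫⁻ p, ‖p.1 - p.2‖ₑ ^ 2 ∂ζ) ^ (1 / 2 : ℝ)

/-- The coefficient `m_t = e^{-t}` of the forward Ornstein-Uhlenbeck process
`dX_t = -X_t dt + √2 dB_t`. -/
def m (t : ℝ) : ℝ := Real.exp (-t)

/-- The coefficient `σ_t`, where `σ_t^2 = 1 - e^{-2t}`. -/
def sig (t : ℝ) : ℝ := Real.sqrt (1 - Real.exp (-2 * t))

/-- The data distribution `N(μ, I_d)`. -/
def dataLaw {d : ℕ} (μ : E d) : Measure (E d) := multivariateGaussian μ 1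

/-- The transition density `x ↦ p_{t|0}(x | y)` of the forward Ornstein-Uhlenbeck process: the
density of `m_t y + σ_t Z` with `Z ∼ N(0, I_d)`, for `t > 0`. -/
def transitionDensity {d : ℕ} (t : ℝ) (y x : E d) : ℝ :=
  ((2 * Real.pi * sig t ^ 2) ^ ((d : ℝ) / 2))⁻¹ *
    Real.exp (-(‖x - m t • y‖ ^ 2 / (2 * sig t ^ 2)))

/-- The density `p_t` of the law of the forward Ornstein-Uhlenbeck process `X_t` started from
`X_0 ∼ N(μ, I_d)`, for `t > 0`. -/
def density {d : ℕ} (μ : E d) (t : ℝ) (x : E d) : ℝ :=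
  ∫ y, transitionDensity t y x ∂(dataLaw μ)

/-- The approximating function `s(t, θ, x) = -x + m_t θ`. -/
def score {d : ℕ} (t : ℝ) (θ x : E d) : E d := -x + m t • θ

/-- The weighting function `κ(t) = σ_t^2`. -/
def kappa (t : ℝ) : ℝ := sig t ^ 2

/-- The score-matching objective
`U(θ) = ∫_0^T κ(t)/T ∫ |∇ log p_t(x) - s(t, θ, x)|^2 p_t(x) dx dt`. -/
def objective {d : ℕ} (T : ℝ) (μ : E d) (θ : E d) : ℝ :=
  ∫ t in (0 : ℝ)..T, kappa t / T *
    ∫ x : E d, ‖gradient (fun y => Real.log (density μ t y)) x - score t θ x‖ ^ 2 * density μ t x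

/-- The uniform distribution on `[0, T]`, the law of `τ`. -/
def timeLaw (T : ℝ) : Measure ℝ := cond volume (Set.Icc 0 T)

/-- The law of `(τ, X_0, Z)`, with independent `τ ∼ Uniform([0, T])`, `X_0 ∼ N(μ, I_d)` and
`Z ∼ N(0, I_d)`. -/
def sampleLaw {d : ℕ} (T : ℝ) (μ : E d) : Measure (ℝ × E d × E d) :=
  (timeLaw T).prod ((dataLaw μ).prod (stdGaussian (E d)))

/-- The stochastic gradient `H(θ, (t, x₀, z))`. -/
def stochGrad {d : ℕ} (θ : E d) (x : ℝ × E d × E d) : E d :=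
  (2 * sig x.1 ^ 2 * m x.1) •
    ((sig x.1)⁻¹ • x.2.2 - m x.1 • x.2.1 - sig x.1 • x.2.2 + m x.1 • θ)

/-- The iterates of stochastic gradient Langevin dynamics with stepsize `lam`, inverse temperature
`β`, initial value `θ₀`, Gaussian noise `ξ` and data `x`. -/
def sgld {d : ℕ} (lam β : ℝ) (θ₀ : E d) (ξ : ℕ → E d) (x : ℕ → ℝ × E d × E d) : ℕ → E d
  | 0 => θ₀
  | n + 1 => sgld lam β θ₀ ξ x n - lam • stochGrad (sgld lam β θ₀ ξ x n) (x (n + 1)) +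
      Real.sqrt (2 * lam / β) • ξ (n + 1)

/-- The Euler-Maruyama scheme with stepsize `γ`, time horizon `T`, parameter `θ`, initial value
`y₀` and Gaussian noise `z`; the `k`-th step uses the score at time `T - t_k`, `t_k = k γ`. -/
def eulerMaruyama {d : ℕ} (γ T : ℝ) (θ y₀ : E d) (z : ℕ → E d) : ℕ → E d
  | 0 => y₀
  | k + 1 => eulerMaruyama γ T θ y₀ z k +
      γ • (eulerMaruyama γ T θ y₀ z k +
        (2 : ℝ) • score (T - k * γ) θ (eulerMaruyama γ T θ y₀ z k)) +
      Real.sqrt (2 * γ) • z (k + 1)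

/-- `E[|X_0|^2]` for `X_0 ∼ N(μ, I_d)`. -/
def dataSecondMoment {d : ℕ} (μ : E d) : ℝ := ∫ x, ‖x‖ ^ 2 ∂(dataLaw μ)

/-- `E[σ_τ^2 m_τ^2]`. -/
def moment2 (T : ℝ) : ℝ := ∫ t, sig t ^ 2 * m t ^ 2 ∂(timeLaw T)

/-- `E[σ_τ^4 m_τ^4]`. -/
def moment4 (T : ℝ) : ℝ := ∫ t, sig t ^ 4 * m t ^ 4 ∂(timeLaw T)

/-- `E[σ_τ^4 m_τ^2 (σ_τ^{-1} |Z| + m_τ |X_0| + σ_τ |Z| + m_τ |θ*|)^2]`. -/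
def gradMoment {d : ℕ} (T : ℝ) (μ θstar : E d) : ℝ :=
  ∫ x, sig x.1 ^ 4 * m x.1 ^ 2 *
    ((sig x.1)⁻¹ * ‖x.2.2‖ + m x.1 * ‖x.2.1‖ + sig x.1 * ‖x.2.2‖ + m x.1 * ‖θstar‖) ^ 2
    ∂(sampleLaw T μ)

/-- `C_{SGLD,1} = 1 / E[σ_τ^2 m_τ^2]`. -/
def CSGLD1 (T : ℝ) : ℝ := 1 / moment2 T

/-- `C_{SGLD,2}`. -/
def CSGLD2 {d : ℕ} (T : ℝ) (μ θstar : E d) : ℝ := 4 * gradMoment T μ θstar / moment2 T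

/-- The largest admissible stepsize of the SGLD algorithm. -/
def lamMax (T : ℝ) : ℝ := min (moment2 T / (4 * moment4 T)) (1 / (2 * moment2 T))

/-- The constant `√(4/3) + 2 √33`. -/
def c0 : ℝ := Real.sqrt (4 / 3) + 2 * Real.sqrt 33

/-- The threshold `T_δ`. -/
def Tdelta {d : ℕ} (μ : E d) (δ : ℝ) : ℝ :=
  Real.log (8 * (Real.sqrt (dataSecondMoment μ) + Real.sqrt (3 * d / 2)) / δ)

/-- The threshold `β_δ`. -/
def betaDelta (d : ℕ) (T δ : ℝ) : ℝ :=
  144 * d * c0 ^ 2 / (δ ^ 2 * ∫ t, kappa t * m t ^ 2 ∂(timeLaw T))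

/-- The threshold `λ_δ`. -/
def lamDelta {d : ℕ} (T : ℝ) (μ θstar : E d) (δ : ℝ) : ℝ :=
  min (lamMax T) (δ ^ 2 * moment2 T * (576 * c0 ^ 2 * gradMoment T μ θstar)⁻¹)

/-- The threshold `n_δ`, where `v = E[|θ_0 - θ*|^2]`. When `v = 0` the logarithm is to be read as
`-∞`; since `Real.log 0 = 0`, the condition `n_δ ≤ n` holds for all `n : ℕ` in this case, as it
should. -/
def nDelta (T lam v δ : ℝ) : ℝ :=
  (lam * moment2 T)⁻¹ * Real.log (12 * c0 * Real.sqrt v / δ)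

/-- The threshold `γ_δ`. -/
def gammaDelta {d : ℕ} (θstar : E d) (δ : ℝ) : ℝ :=
  min (δ / (4 * Real.sqrt (18 * d + 132 * ‖θstar‖ ^ 2))) (1 / 2)

end ScoreDiffusion

end

open ScoreDiffusion

/-!
The scheme is linear and everything is Gaussian, so each error source can be computed explicitly.

*The minimiser.* Since `m_t ^ 2 + σ_t ^ 2 = 1`, the marginal `p_t` is the density of `N(m_t μ, I_d)`
(`density_eq`), so `∇ log p_t(x) = -x + m_t μ = s(t, μ, x)`. The objective is therefore a positive
multiple of `‖μ - θ‖ ^ 2`, and `θ* = μ` (`eq_of_isMinOn_objective`).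

*The Langevin iterates.* The stochastic gradient is affine in `θ` with the random slope
`2 σ_τ ^ 2 m_τ ^ 2`, and at `θ = μ` it is centred given `τ`. Hence one step splits
`θ_{n+1} - μ` into three orthogonal terms (`sgld_step`), which gives
`E‖θ_{n+1} - μ‖ ^ 2 ≤ E(1 - 2 λ σ_τ ^ 2 m_τ ^ 2) ^ 2 E‖θ_n - μ‖ ^ 2 + 4 λ ^ 2 G + 2 λ d / β`. The bound on
`λ` makes the factor at most `1 - 2 λ E[σ_τ ^ 2 m_τ ^ 2]`, and the recursion is solved in
`sgld_memLp_and_error_le`.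

*The sampler.* With `θ̂` fixed the Euler-Maruyama output is `A θ̂ + √v N`, where `A` and `v` are
deterministic (`emCoeff`, `emVar`) and `N` is standard Gaussian (`hasLaw_eulerMaruyama_zero`).
Elementary recursions give `1 - γ - e^{-T} ≤ A ≤ 1` and `1 ≤ v ≤ 1 + γ`. Coupling the output with
`μ + N` and using Minkowski's inequality bounds the Wasserstein distance by
`(E‖θ̂ - μ‖ ^ 2)^{1/2} + (γ + e^{-T}) ‖μ‖ + γ √d` (`W2_eulerMaruyama_le`), which is smaller than the
claimed bound. The thresholds then bound three groups of terms by fractions of `δ` whose sum is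
below `1` (`error_bound_lt`).
-/

namespace ScoreDiffusion

/-! ### Gaussian measures -/

lemma dataLaw_eq_map {d : ℕ} (μ : E d) :
    dataLaw μ = (stdGaussian (E d)).map (fun z => μ + z) := by
  simp [dataLaw, multivariateGaussian]

instance isGaussian_dataLaw {d : ℕ} (μ : E d) : IsGaussian (dataLaw μ) := by
  unfold dataLaw; infer_instance

lemma integral_id_dataLaw {d : ℕ} (μ : E d) : ∫ x, x ∂(dataLaw μ) = μ :=
  integral_id_multivariateGaussian

lemma integral_norm_sq_stdGaussian (d : ℕ) : ∫ z, ‖z‖ ^ 2 ∂(stdGaussian (E d)) = d := by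
  have h1 : ∫ x : ℝ, x ^ 2 ∂(gaussianReal 0 1) = 1 := by
    have := variance_fun_id_gaussianReal (μ := 0) (v := 1)
    rw [variance_eq_integral (by fun_prop)] at this
    simpa using this
  have hi : Integrable (fun x : ℝ => x ^ 2) (gaussianReal 0 1) :=
    (memLp_id_gaussianReal (μ := 0) (v := 1) 2).integrable_sq
  rw [← map_pi_eq_stdGaussian, integral_map (by fun_prop) (by fun_prop)]
  simp_rw [EuclideanSpace.real_norm_sq_eq]
  rw [integral_finsetSum]
  · have : ∀ i : Fin d, ∫ x : Fin d → ℝ, x i ^ 2 ∂(Measure.pi fun _ => gaussianReal 0 1) = 1 := by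
      intro i
      rw [← h1]
      exact integral_comp_eval (μ := fun _ : Fin d => gaussianReal 0 1) (i := i)
        (f := fun x : ℝ => x ^ 2) (by fun_prop)
    simp [this]
  · intro i _
    exact integrable_comp_eval (μ := fun _ : Fin d => gaussianReal 0 1) (i := i)
        (f := fun x : ℝ => x ^ 2) hi

lemma norm_le_sqrt_dataSecondMoment {d : ℕ} (μ : E d) : ‖μ‖ ≤ Real.sqrt (dataSecondMoment μ) := by
  have hL : MemLp (fun x : E d => ‖x‖) 2 (dataLaw μ) :=
    (IsGaussian.memLp_two_id (μ := dataLaw μ)).norm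
  have h1 : ‖μ‖ ≤ ∫ x, ‖x‖ ∂(dataLaw μ) := by
    conv_lhs => rw [← integral_id_dataLaw μ]
    exact norm_integral_le_integral_norm _
  have h2 : 0 ≤ Var[fun x : E d => ‖x‖; dataLaw μ] := variance_nonneg _ _
  rw [variance_eq_sub hL] at h2
  apply Real.le_sqrt_of_sq_le
  calc ‖μ‖ ^ 2 ≤ (∫ x, ‖x‖ ∂(dataLaw μ)) ^ 2 := by gcongr
    _ ≤ _ := by
      have : (∫ x, ‖x‖ ∂(dataLaw μ)) ^ 2 ≤ ∫ x, ‖x‖ ^ 2 ∂(dataLaw μ) := by simpa using h2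
      exact this

/-- Independent standard Gaussian vectors are stable under normalised linear combinations. -/
lemma hasLaw_stdGaussian_add {d : ℕ} {Ω : Type*} [MeasurableSpace Ω] {P : Measure Ω}
    [IsProbabilityMeasure P] {U W : Ω → E d} (hU : HasLaw U (stdGaussian (E d)) P)
    (hW : HasLaw W (stdGaussian (E d)) P) (h : IndepFun U W P) {a b : ℝ} (hab : a ^ 2 + b ^ 2 = 1) :
    HasLaw (fun ω => a • U ω + b • W ω) (stdGaussian (E d)) P := by
  have hU' := hU.aemeasurable
  have hW' := hW.aemeasurable
  refine ⟨by fun_prop, ?_⟩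
  have hmap : ∀ (c : ℝ) (V : Ω → E d), HasLaw V (stdGaussian (E d)) P →
      P.map (fun ω => c • V ω) = (stdGaussian (E d)).map (fun x => c • x) := by
    intro c V hV
    have hV' := hV.aemeasurable
    rw [← hV.map_eq, AEMeasurable.map_map_of_aemeasurable (by fun_prop) hV']
    rfl
  apply Measure.ext_of_charFun
  have hind : IndepFun (fun ω => a • U ω) (fun ω => b • W ω) P :=
    h.comp (φ := fun x => a • x) (ψ := fun x => b • x) (by fun_prop) (by fun_prop)
  rw [hind.charFun_map_fun_add_eq_mul (by fun_prop) (by fun_prop), hmap a U hU, hmap b W hW]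
  ext t
  simp only [Pi.mul_apply, charFun_map_smul, charFun_stdGaussian]
  rw [← Complex.exp_add]
  congr 1
  simp only [norm_smul, Complex.ofReal_mul, mul_pow]
  have h1 : (((‖a‖ ^ 2 + ‖b‖ ^ 2 : ℝ)) : ℂ) = 1 := by simp [hab]
  push_cast at h1
  linear_combination (-(‖t‖ : ℂ) ^ 2 / 2) * h1

/-! ### The score of the forward process -/

lemma integral_exp_gaussianReal {a m s : ℝ} (hs : 0 < s) (hms : m ^ 2 + s = 1) :
    ∫ z, Real.exp (-((a - m * z) ^ 2 / (2 * s))) ∂(gaussianReal 0 1) =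
      Real.sqrt s * Real.exp (-(a ^ 2 / 2)) := by
  obtain ⟨v, rfl⟩ : ∃ v : NNReal, (v : ℝ) = s := ⟨⟨s, hs.le⟩, rfl⟩
  rw [integral_gaussianReal_eq_integral_smul (by norm_num)]
  -- completing the square in the product of the two Gaussian densities
  have : ∀ z : ℝ, gaussianPDFReal 0 1 z • Real.exp (-((a - m * z) ^ 2 / (2 * v))) =
      (Real.sqrt v * Real.exp (-(a ^ 2 / 2))) * gaussianPDFReal (m * a) v z := by
    intro z
    simp only [gaussianPDFReal, smul_eq_mul, NNReal.coe_one]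
    rw [Real.sqrt_mul (by positivity) (v : ℝ)]
    have hss : Real.sqrt (v : ℝ) ≠ 0 := by positivity
    have he : Real.exp (-(z - 0) ^ 2 / (2 * 1)) * Real.exp (-((a - m * z) ^ 2 / (2 * v))) =
        Real.exp (-(a ^ 2 / 2)) * Real.exp (-(z - m * a) ^ 2 / (2 * v)) := by
      rw [← Real.exp_add, ← Real.exp_add]
      congr 1
      field_simp
      linear_combination (a ^ 2 - z ^ 2) * hms
    rw [mul_assoc, he, mul_one]
    field_simp
  simp_rw [this]
  rw [integral_const_mul, integral_gaussianPDFReal_eq_one _ (by exact_mod_cast hs.ne'), mul_one]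

lemma integral_exp_stdGaussian {d : ℕ} {m s : ℝ} (hs : 0 < s) (hms : m ^ 2 + s = 1) (w : E d) :
    ∫ z, Real.exp (-(‖w - m • z‖ ^ 2 / (2 * s))) ∂(stdGaussian (E d)) =
      Real.sqrt s ^ d * Real.exp (-(‖w‖ ^ 2 / 2)) := by
  rw [← map_pi_eq_stdGaussian, integral_map (by fun_prop) (by fun_prop)]
  have : ∀ x : Fin d → ℝ, Real.exp (-(‖w - m • WithLp.toLp 2 x‖ ^ 2 / (2 * s))) =
      ∏ i, Real.exp (-((w i - m * x i) ^ 2 / (2 * s))) := by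
    intro x
    rw [← Real.exp_sum, EuclideanSpace.real_norm_sq_eq, Finset.sum_neg_distrib, Finset.sum_div]
    simp
  simp_rw [this]
  rw [integral_fintype_prod_eq_prod (μ := fun _ : Fin d => gaussianReal 0 1)
    (f := fun i z => Real.exp (-((w i - m * z) ^ 2 / (2 * s))))]
  simp_rw [integral_exp_gaussianReal hs hms]
  rw [Finset.prod_mul_distrib, ← Real.exp_sum, EuclideanSpace.real_norm_sq_eq,
    Finset.sum_neg_distrib, Finset.sum_div]
  simp

lemma sig_sq {t : ℝ} (ht : 0 ≤ t) : sig t ^ 2 = 1 - Real.exp (-2 * t) := by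
  rw [sig, Real.sq_sqrt]
  have : Real.exp (-2 * t) ≤ 1 := Real.exp_le_one_iff.2 (by linarith)
  linarith

lemma m_sq (t : ℝ) : m t ^ 2 = Real.exp (-2 * t) := by
  rw [m, ← Real.exp_nat_mul]; congr 1; push_cast; ring

lemma sig_sq_pos {t : ℝ} (ht : 0 < t) : 0 < sig t ^ 2 := by
  rw [sig_sq ht.le]
  have : Real.exp (-2 * t) < 1 := Real.exp_lt_one_iff.2 (by linarith)
  linarith

/-- The marginal `p_t` is the density of `N(m_t μ, I_d)`, because `m_t ^ 2 + σ_t ^ 2 = 1`. -/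
lemma density_eq {d : ℕ} (μ : E d) {t : ℝ} (ht : 0 < t) (x : E d) :
    density μ t x =
      ((2 * Real.pi) ^ ((d : ℝ) / 2))⁻¹ * Real.exp (-(‖x - m t • μ‖ ^ 2 / 2)) := by
  have hs := sig_sq_pos ht
  have hc : ((2 * Real.pi) ^ ((d : ℝ) / 2))⁻¹ =
      ((2 * Real.pi * sig t ^ 2) ^ ((d : ℝ) / 2))⁻¹ * Real.sqrt (sig t ^ 2) ^ d := by
    have h1 : Real.sqrt (sig t ^ 2) ^ d = (sig t ^ 2) ^ ((d : ℝ) / 2) := by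
      rw [Real.sqrt_eq_rpow, ← Real.rpow_natCast, ← Real.rpow_mul hs.le]
      congr 1; ring
    rw [h1, Real.mul_rpow (by positivity) hs.le]
    have := (Real.rpow_pos_of_pos hs ((d : ℝ) / 2)).ne'
    field_simp
  unfold density transitionDensity
  rw [integral_const_mul, dataLaw_eq_map, integral_map (by fun_prop) (by fun_prop), hc]
  simp_rw [smul_add, sub_add_eq_sub_sub]
  rw [integral_exp_stdGaussian (m := m t) hs (by rw [m_sq, sig_sq ht.le]; ring)]
  ring

lemma integral_density {d : ℕ} (μ : E d) {t : ℝ} (ht : 0 < t) : ∫ x, density μ t x = 1 := by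
  simp_rw [density_eq μ ht]
  rw [integral_const_mul, integral_sub_right_eq_self (fun x : E d => Real.exp (-(‖x‖ ^ 2 / 2)))]
  have := GaussianFourier.integral_rexp_neg_mul_sq_norm (V := E d) (b := 1 / 2) (by norm_num)
  rw [finrank_euclideanSpace_fin, show Real.pi / (1 / 2) = 2 * Real.pi by ring] at this
  rw [inv_mul_eq_one₀ (by positivity), ← this]
  congr 1 with x
  congr 1; ring

lemma gradient_log_density {d : ℕ} (μ : E d) {t : ℝ} (ht : 0 < t) (x : E d) :
    gradient (fun y => Real.log (density μ t y)) x = -x + m t • μ := by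
  set c := ((2 * Real.pi) ^ ((d : ℝ) / 2))⁻¹ with hc
  have hc0 : c ≠ 0 := by positivity
  have : (fun y => Real.log (density μ t y)) =
      fun y => Real.log c + -((1 / 2 : ℝ) * ‖y - m t • μ‖ ^ 2) := by
    ext y
    rw [density_eq μ ht, Real.log_mul hc0 (Real.exp_ne_zero _), Real.log_exp]
    ring
  rw [this]
  apply HasGradientAt.gradient
  rw [hasGradientAt_iff_hasFDerivAt]
  have h1 : HasFDerivAt (fun y : E d => y - m t • μ) (ContinuousLinearMap.id ℝ (E d)) x :=
    (hasFDerivAt_id x).sub_const _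
  have h2 := ((h1.norm_sq.const_mul (1 / 2 : ℝ)).neg.const_add (Real.log c))
  convert! h2 using 1
  ext v
  rw [InnerProductSpace.toDual_apply_apply]
  simp only [neg_apply, smul_apply,
    ContinuousLinearMap.comp_apply, ContinuousLinearMap.id_apply, innerSL_apply_apply,
    inner_add_left, inner_sub_left, inner_neg_left, smul_eq_mul, nsmul_eq_mul]
  push_cast
  ring

lemma objective_eq {d : ℕ} {T : ℝ} (hT : 0 < T) (μ θ : E d) :
    objective T μ θ = (∫ t in (0 : ℝ)..T, kappa t / T * m t ^ 2) * ‖μ - θ‖ ^ 2 := by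
  unfold objective
  rw [← intervalIntegral.integral_mul_const]
  apply intervalIntegral.integral_congr_ae
  refine Filter.Eventually.of_forall fun t ht => ?_
  rw [Set.uIoc_of_le hT.le] at ht
  simp_rw [gradient_log_density μ ht.1]
  have : ∀ x : E d, ‖-x + m t • μ - score t θ x‖ ^ 2 = m t ^ 2 * ‖μ - θ‖ ^ 2 := by
    intro x
    rw [score, add_sub_add_left_eq_sub, ← smul_sub, norm_smul, mul_pow, Real.norm_eq_abs, sq_abs]
  simp_rw [this]
  rw [integral_const_mul, integral_density μ ht.1]
  ring

lemma continuous_sig : Continuous sig := by unfold sig; fun_prop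

lemma continuous_m : Continuous m := by unfold m; fun_prop

/-- The score-matching objective has the mean of the data distribution as its only minimiser. -/
lemma eq_of_isMinOn_objective {d : ℕ} {T : ℝ} (hT : 0 < T) {μ θ : E d}
    (h : IsMinOn (objective T μ) Set.univ θ) : θ = μ := by
  have hpos : 0 < ∫ t in (0 : ℝ)..T, kappa t / T * m t ^ 2 := by
    apply intervalIntegral.intervalIntegral_pos_of_pos_on _ _ hT
    · apply Continuous.intervalIntegrable
      have := continuous_sig
      have := continuous_m
      unfold kappa
      fun_prop
    · intro t ht
      have := sig_sq_pos ht.1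
      have : 0 < m t := Real.exp_pos _
      unfold kappa
      positivity
  have h1 : objective T μ θ ≤ objective T μ μ := h (Set.mem_univ μ)
  rw [objective_eq hT, objective_eq hT, sub_self, norm_zero] at h1
  have h2 : ‖μ - θ‖ ^ 2 ≤ 0 := by
    by_contra! h3
    nlinarith [mul_pos hpos h3]
  have h3 : ‖μ - θ‖ = 0 := by nlinarith [norm_nonneg (μ - θ)]
  exact (sub_eq_zero.1 (norm_eq_zero.1 h3)).symm

/-! ### Independence and second moments -/

/-- If `U` is independent of `(V, W)` and `V` is independent of `W`, then `U, V, W` are mutually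
independent, so `(U, V)` is independent of `W`. -/
lemma indepFun_prodMk_left {Ω α β δ : Type*} [MeasurableSpace Ω] [MeasurableSpace α]
    [MeasurableSpace β] [MeasurableSpace δ] {P : Measure Ω} [IsProbabilityMeasure P]
    {U : Ω → α} {V : Ω → β} {W : Ω → δ} (hU : Measurable U) (hV : Measurable V) (hW : Measurable W)
    (h : IndepFun U (fun ω => (V ω, W ω)) P) (hVW : IndepFun V W P) :
    IndepFun (fun ω => (U ω, V ω)) W P := by
  have := Measure.isProbabilityMeasure_map (μ := P) hU.aemeasurable
  have := Measure.isProbabilityMeasure_map (μ := P) hV.aemeasurable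
  have := Measure.isProbabilityMeasure_map (μ := P) hW.aemeasurable
  have hUV : IndepFun U V P := h.comp (φ := id) (ψ := Prod.fst) measurable_id measurable_fst
  rw [indepFun_iff_map_prod_eq_prod_map_map (by fun_prop) (by fun_prop)] at h hVW hUV ⊢
  rw [hVW] at h
  rw [hUV]
  apply (MeasurableEquiv.prodAssoc (α := α) (β := β) (γ := δ)).map_measurableEquiv_injective
  rw [Measure.prodAssoc_prod, Measure.map_map (by fun_prop) (by fun_prop)]
  exact h

lemma integrable_inner_of_memLp {d : ℕ} {Ω : Type*} [MeasurableSpace Ω] {P : Measure Ω}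
    {U V : Ω → E d} (hU : MemLp U 2 P) (hV : MemLp V 2 P) :
    Integrable (fun ω => inner ℝ (U ω) (V ω)) P := by
  refine (hU.norm.integrable_mul hV.norm).mono (hU.1.inner hV.1) ?_
  refine Filter.Eventually.of_forall fun ω => ?_
  simpa using norm_inner_le_norm (𝕜 := ℝ) (U ω) (V ω)

lemma integral_norm_sq_add {d : ℕ} {Ω : Type*} [MeasurableSpace Ω] {P : Measure Ω}
    {U V : Ω → E d} (hU : MemLp U 2 P) (hV : MemLp V 2 P)
    (h : ∫ ω, inner ℝ (U ω) (V ω) ∂P = 0) :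
    ∫ ω, ‖U ω + V ω‖ ^ 2 ∂P = ∫ ω, ‖U ω‖ ^ 2 ∂P + ∫ ω, ‖V ω‖ ^ 2 ∂P := by
  simp_rw [norm_add_sq_real]
  have h1 := hU.norm.integrable_sq
  have h2 := hV.norm.integrable_sq
  have h3 := (integrable_inner_of_memLp hU hV).const_mul 2
  have h4 : Integrable (fun ω => ‖U ω‖ ^ 2 + 2 * inner ℝ (U ω) (V ω)) P := h1.add h3
  rw [integral_add h4 h2, integral_add h1 h3, integral_const_mul, h]
  ring

lemma integral_inner_of_indepFun {d : ℕ} {Ω : Type*} [MeasurableSpace Ω] {P : Measure Ω}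
    {U V : Ω → E d} (hU : Integrable U P) (hV : Integrable V P)
    (h : IndepFun U V P) :
    ∫ ω, inner ℝ (U ω) (V ω) ∂P = inner ℝ (∫ ω, U ω ∂P) (∫ ω, V ω ∂P) := by
  exact h.integral_bilin hU hV (innerSL ℝ)

/-! ### The stochastic gradient -/

lemma sig_nonneg (t : ℝ) : 0 ≤ sig t := Real.sqrt_nonneg _

lemma m_pos (t : ℝ) : 0 < m t := Real.exp_pos _

lemma sig_le_one (t : ℝ) : sig t ≤ 1 := by
  rw [sig, Real.sqrt_le_one]
  linarith [Real.exp_pos (-2 * t)]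

lemma sig_mul_m_le_one (t : ℝ) : sig t * m t ≤ 1 := by
  rcases le_or_gt 0 t with ht | ht
  · exact mul_le_one₀ (sig_le_one t) (m_pos t).le (Real.exp_le_one_iff.2 (by linarith))
  · have : sig t = 0 := Real.sqrt_eq_zero_of_nonpos (by
      linarith [Real.one_le_exp (x := -2 * t) (by linarith)])
    simp [this]

lemma sig_sq_mul_m_le_one (t : ℝ) : sig t ^ 2 * m t ≤ 1 := by
  nlinarith [sig_mul_m_le_one t, sig_nonneg t, sig_le_one t, mul_nonneg (sig_nonneg t) (m_pos t).le]

lemma sig_sq_mul_m_sq_le_one (t : ℝ) : sig t ^ 2 * m t ^ 2 ≤ 1 := by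
  rw [← mul_pow]
  exact pow_le_one₀ (mul_nonneg (sig_nonneg t) (m_pos t).le) (sig_mul_m_le_one t)

lemma measurable_sig : Measurable sig := continuous_sig.measurable

lemma measurable_m : Measurable m := continuous_m.measurable

lemma isProbabilityMeasure_timeLaw {T : ℝ} (hT : 0 < T) : IsProbabilityMeasure (timeLaw T) := by
  apply cond_isProbabilityMeasure_of_finite <;> simp [hT]

lemma isProbabilityMeasure_sampleLaw {d : ℕ} {T : ℝ} (hT : 0 < T) (μ : E d) :
    IsProbabilityMeasure (sampleLaw T μ) := by
  have := isProbabilityMeasure_timeLaw hT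
  unfold sampleLaw
  infer_instance

lemma _root_.Measurable.stochGrad {α : Type*} [MeasurableSpace α] {d : ℕ} {f : α → E d}
    {g : α → ℝ × E d × E d} (hf : Measurable f) (hg : Measurable g) :
    Measurable (fun a => stochGrad (f a) (g a)) := by
  have := measurable_sig
  have := measurable_m
  unfold ScoreDiffusion.stochGrad
  fun_prop

/-- The stochastic gradient is affine in the parameter. -/
lemma stochGrad_eq_add {d : ℕ} (θ μ : E d) (x : ℝ × E d × E d) :
    stochGrad θ x = stochGrad μ x + (2 * (sig x.1 ^ 2 * m x.1 ^ 2)) • (θ - μ) := by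
  simp only [stochGrad]
  module

/-- Half of the bound on `‖stochGrad θ x‖` given by the triangle inequality; its square is the
integrand of `gradMoment`. -/
noncomputable def gradBound {d : ℕ} (θ : E d) (x : ℝ × E d × E d) : ℝ :=
  sig x.1 ^ 2 * m x.1 *
    ((sig x.1)⁻¹ * ‖x.2.2‖ + m x.1 * ‖x.2.1‖ + sig x.1 * ‖x.2.2‖ + m x.1 * ‖θ‖)

lemma gradBound_nonneg {d : ℕ} (θ : E d) (x : ℝ × E d × E d) : 0 ≤ gradBound θ x := by
  have := sig_nonneg x.1
  have := m_pos x.1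
  unfold gradBound
  positivity

lemma integral_gradBound_sq {d : ℕ} (T : ℝ) (μ θ : E d) :
    ∫ x, gradBound θ x ^ 2 ∂(sampleLaw T μ) = gradMoment T μ θ := by
  unfold gradMoment gradBound
  congr 1 with x
  ring

lemma norm_stochGrad_le {d : ℕ} (θ : E d) (x : ℝ × E d × E d) :
    ‖stochGrad θ x‖ ≤ 2 * gradBound θ x := by
  have h1 := sig_nonneg x.1
  have h2 := (m_pos x.1).le
  have h3 := inv_nonneg.2 h1
  rw [stochGrad, gradBound, norm_smul, Real.norm_of_nonneg (by positivity), ← mul_assoc 2,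
    ← mul_assoc 2]
  gcongr
  refine (norm_add_le _ _).trans ?_
  refine (add_le_add_left ((norm_sub_le _ _).trans
    (add_le_add_left (norm_sub_le _ _) _)) _).trans_eq ?_
  simp only [norm_smul, Real.norm_of_nonneg h1, Real.norm_of_nonneg h2, Real.norm_of_nonneg h3]

lemma gradBound_le {d : ℕ} (θ : E d) (x : ℝ × E d × E d) :
    gradBound θ x ≤ 2 * ‖x.2.2‖ + ‖x.2.1‖ + ‖θ‖ := by
  have h1 := sig_nonneg x.1
  have h2 := (m_pos x.1).le
  -- the factor `σ_t ^ 2` absorbs the singularity of `σ_t⁻¹` at `t = 0`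
  have h0 : sig x.1 ^ 2 * (sig x.1)⁻¹ = sig x.1 := by
    rcases eq_or_ne (sig x.1) 0 with h | h
    · simp [h]
    · field_simp
  have e : gradBound θ x = (sig x.1 * m x.1) * ‖x.2.2‖ + (sig x.1 ^ 2 * m x.1 ^ 2) * ‖x.2.1‖ +
      (sig x.1 * (sig x.1 ^ 2 * m x.1)) * ‖x.2.2‖ + (sig x.1 ^ 2 * m x.1 ^ 2) * ‖θ‖ := by
    unfold gradBound
    linear_combination (m x.1 * ‖x.2.2‖) * h0
  have h3 : sig x.1 * (sig x.1 ^ 2 * m x.1) ≤ 1 :=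
    mul_le_one₀ (sig_le_one _) (by positivity) (sig_sq_mul_m_le_one _)
  have h4 := mul_le_mul_of_nonneg_right (sig_mul_m_le_one x.1) (norm_nonneg x.2.2)
  have h5 := mul_le_mul_of_nonneg_right (sig_sq_mul_m_sq_le_one x.1) (norm_nonneg x.2.1)
  have h6 := mul_le_mul_of_nonneg_right h3 (norm_nonneg x.2.2)
  have h7 := mul_le_mul_of_nonneg_right (sig_sq_mul_m_sq_le_one x.1) (norm_nonneg θ)
  linarith

lemma memLp_gradBound {d : ℕ} {T : ℝ} (hT : 0 < T) (μ θ : E d) :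
    MemLp (gradBound θ) 2 (sampleLaw T μ) := by
  have := isProbabilityMeasure_timeLaw hT
  have hs := measurable_sig
  have hm := measurable_m
  have hdata : MemLp (fun x : ℝ × E d × E d => x.2.1) 2 (sampleLaw T μ) :=
    ((IsGaussian.memLp_two_id (μ := dataLaw μ)).comp_fst (stdGaussian (E d))).comp_snd (timeLaw T)
  have hnoise : MemLp (fun x : ℝ × E d × E d => x.2.2) 2 (sampleLaw T μ) :=
    ((IsGaussian.memLp_two_id (μ := stdGaussian (E d))).comp_snd (dataLaw μ)).comp_snd (timeLaw T)
  have := isProbabilityMeasure_sampleLaw hT μ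
  refine (((hnoise.norm.const_mul 2).add hdata.norm).add (memLp_const ‖θ‖)).mono ?_ ?_
  · unfold gradBound
    exact Measurable.aestronglyMeasurable (by fun_prop)
  · refine Filter.Eventually.of_forall fun x => ?_
    rw [Real.norm_of_nonneg (gradBound_nonneg θ x)]
    exact (gradBound_le θ x).trans (le_abs_self _)

lemma memLp_stochGrad {d : ℕ} {T : ℝ} (hT : 0 < T) (μ θ : E d) :
    MemLp (stochGrad θ) 2 (sampleLaw T μ) := by
  refine ((memLp_gradBound hT μ θ).const_mul 2).mono
    (measurable_const.stochGrad measurable_id).aestronglyMeasurable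
    (Filter.Eventually.of_forall fun x => ?_)
  exact (norm_stochGrad_le θ x).trans (le_abs_self _)

/-- The stochastic gradient at the mean of the data distribution is centred conditionally on the
time variable. -/
lemma integral_smul_stochGrad_self {d : ℕ} {T : ℝ} (hT : 0 < T) (μ : E d) {w : ℝ → ℝ}
    (hw : Measurable w) {C : ℝ} (hC : ∀ t, |w t| ≤ C) :
    ∫ x, w x.1 • stochGrad μ x ∂(sampleLaw T μ) = 0 := by
  have := isProbabilityMeasure_timeLaw hT
  have := isProbabilityMeasure_sampleLaw hT μ
  have hint : Integrable (fun x : ℝ × E d × E d => w x.1 • stochGrad μ x) (sampleLaw T μ) :=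
    ((memLp_stochGrad hT μ μ).integrable (by norm_num)).bdd_smul C
      (hw.comp measurable_fst).aestronglyMeasurable (Filter.Eventually.of_forall fun x => hC x.1)
  unfold sampleLaw at hint ⊢
  rw [integral_prod _ hint]
  refine (integral_congr_ae (Filter.Eventually.of_forall fun t => ?_)).trans (integral_zero _ _)
  have i1 : Integrable (fun y : E d × E d => y.2) ((dataLaw μ).prod (stdGaussian (E d))) :=
    (IsGaussian.integrable_id (μ := stdGaussian (E d))).comp_snd (dataLaw μ)
  have i2 : Integrable (fun y : E d × E d => y.1) ((dataLaw μ).prod (stdGaussian (E d))) :=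
    (IsGaussian.integrable_id (μ := dataLaw μ)).comp_fst (stdGaussian (E d))
  have e1 : ∫ y : E d × E d, y.2 ∂((dataLaw μ).prod (stdGaussian (E d))) = 0 := by
    rw [integral_fun_snd (fun y : E d => y)]; simp
  have e2 : ∫ y : E d × E d, y.1 ∂((dataLaw μ).prod (stdGaussian (E d))) = μ := by
    rw [integral_fun_fst (fun y : E d => y)]; simp [integral_id_dataLaw]
  have i3 (c : ℝ) : Integrable (fun y : E d × E d => c • y.2)
    ((dataLaw μ).prod (stdGaussian (E d))) := i1.smul c
  have i4 : Integrable (fun y : E d × E d => m t • y.1)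
    ((dataLaw μ).prod (stdGaussian (E d))) := i2.smul (m t)
  have i5 : Integrable (fun y : E d × E d => (sig t)⁻¹ • y.2 - m t • y.1)
    ((dataLaw μ).prod (stdGaussian (E d))) := (i3 _).sub i4
  have i6 : Integrable (fun y : E d × E d => (sig t)⁻¹ • y.2 - m t • y.1 - sig t • y.2)
    ((dataLaw μ).prod (stdGaussian (E d))) := i5.sub (i3 _)
  simp only [stochGrad]
  rw [integral_smul, integral_smul, integral_add i6 (integrable_const _),
    integral_sub i5 (i3 _), integral_sub (i3 _) i4, integral_smul, integral_smul, integral_smul,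
    e1, e2]
  simp

/-! ### Mean square error of stochastic gradient Langevin dynamics -/

lemma integral_sq_one_sub_timeLaw {T : ℝ} (hT : 0 < T) (lam : ℝ) :
    ∫ t, (1 - 2 * lam * (sig t ^ 2 * m t ^ 2)) ^ 2 ∂(timeLaw T) =
      1 - 4 * lam * moment2 T + 4 * lam ^ 2 * moment4 T := by
  have := isProbabilityMeasure_timeLaw hT
  have hs := measurable_sig
  have hm := measurable_m
  have hq : ∀ t, ‖sig t ^ 2 * m t ^ 2‖ ≤ 1 := fun t => by
    rw [Real.norm_of_nonneg (by positivity)]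
    exact sig_sq_mul_m_sq_le_one t
  have i1 : Integrable (fun t => sig t ^ 2 * m t ^ 2) (timeLaw T) :=
    Integrable.of_bound (C := 1) (Measurable.aestronglyMeasurable (by fun_prop))
      (Filter.Eventually.of_forall hq)
  have i2 : Integrable (fun t => sig t ^ 4 * m t ^ 4) (timeLaw T) := by
    refine Integrable.of_bound (C := 1) (Measurable.aestronglyMeasurable (by fun_prop))
      (Filter.Eventually.of_forall fun t => ?_)
    rw [show sig t ^ 4 * m t ^ 4 = (sig t ^ 2 * m t ^ 2) ^ 2 by ring, norm_pow]
    exact pow_le_one₀ (norm_nonneg _) (hq t)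
  have e : ∀ t, (1 - 2 * lam * (sig t ^ 2 * m t ^ 2)) ^ 2 =
      1 - 4 * lam * (sig t ^ 2 * m t ^ 2) + 4 * lam ^ 2 * (sig t ^ 4 * m t ^ 4) := fun t => by ring
  have i3 : Integrable (fun t => 1 - 4 * lam * (sig t ^ 2 * m t ^ 2)) (timeLaw T) :=
    (integrable_const 1).sub (i1.const_mul _)
  simp_rw [e]
  rw [integral_add i3 (i2.const_mul _), integral_sub (integrable_const 1) (i1.const_mul _),
    integral_const_mul, integral_const_mul]
  simp [moment2, moment4]

lemma integral_norm_sq_stochGrad_le {d : ℕ} {T : ℝ} (hT : 0 < T) (μ θ : E d) :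
    ∫ x, ‖stochGrad θ x‖ ^ 2 ∂(sampleLaw T μ) ≤ 4 * gradMoment T μ θ := by
  rw [← integral_gradBound_sq, ← integral_const_mul]
  refine integral_mono (memLp_stochGrad hT μ θ).norm.integrable_sq
    ((memLp_gradBound hT μ θ).integrable_sq.const_mul 4) fun x => ?_
  calc ‖stochGrad θ x‖ ^ 2 ≤ (2 * gradBound θ x) ^ 2 := by
        gcongr; exact norm_stochGrad_le θ x
    _ = _ := by ring

/-- One step of the Langevin recursion. Since the stochastic gradient is affine in the parameter
and centred at `μ` given the time variable, the mean square distance to `μ` is a sum of three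
orthogonal contributions: the contracted previous error, the gradient noise and the injected
Gaussian noise. -/
lemma sgld_step {d : ℕ} {T : ℝ} (hT : 0 < T) (μ : E d) {Ω : Type*} [MeasurableSpace Ω]
    {P : Measure Ω} [IsProbabilityMeasure P] {θ ξ : Ω → E d} {X : Ω → ℝ × E d × E d}
    (lam c : ℝ) (hθ : MemLp θ 2 P) (hθm : Measurable θ) (hXm : Measurable X)
    (hξ : HasLaw ξ (stdGaussian (E d)) P) (hX : HasLaw X (sampleLaw T μ) P)
    (h1 : IndepFun θ X P) (h2 : IndepFun (fun ω => (θ ω, X ω)) ξ P) :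
    MemLp (fun ω => θ ω - lam • stochGrad (θ ω) (X ω) + c • ξ ω) 2 P ∧
    ∫ ω, ‖θ ω - lam • stochGrad (θ ω) (X ω) + c • ξ ω - μ‖ ^ 2 ∂P ≤
      (1 - 4 * lam * moment2 T + 4 * lam ^ 2 * moment4 T) * ∫ ω, ‖θ ω - μ‖ ^ 2 ∂P +
        4 * lam ^ 2 * gradMoment T μ μ + c ^ 2 * d := by
  have := isProbabilityMeasure_timeLaw hT
  have hs := measurable_sig
  have hm := measurable_m
  have hsgμ : Measurable (stochGrad μ) := measurable_const.stochGrad measurable_id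
  set w : ℝ → ℝ := fun t => 1 - 2 * lam * (sig t ^ 2 * m t ^ 2) with hw
  have hwm : Measurable w := by fun_prop
  have hwb : ∀ t, |w t| ≤ 1 + 2 * |lam| := fun t => by
    have ha : |sig t ^ 2 * m t ^ 2| ≤ 1 := by
      rw [abs_of_nonneg (by positivity)]; exact sig_sq_mul_m_sq_le_one t
    calc |w t| ≤ |(1 : ℝ)| + |2 * lam * (sig t ^ 2 * m t ^ 2)| := abs_sub _ _
      _ = 1 + 2 * |lam| * |sig t ^ 2 * m t ^ 2| := by rw [abs_mul, abs_mul]; simp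
      _ ≤ 1 + 2 * |lam| * 1 := by gcongr
      _ = _ := by ring
  have hgX : MemLp (fun ω => stochGrad μ (X ω)) 2 P :=
    (memLp_stochGrad hT μ μ).comp_measurePreserving (hX.measurePreserving hXm)
  have hξL : MemLp ξ 2 P := hξ.hasGaussianLaw.memLp_two
  have hΔ : MemLp (fun ω => θ ω - μ) 2 P := hθ.sub (memLp_const μ)
  have hwX : Measurable fun ω => w (X ω).1 := by fun_prop
  have hU : MemLp (fun ω => w (X ω).1 • (θ ω - μ)) 2 P :=
    hΔ.smul (r := 2) (p := ⊤) (memLp_top_of_bound hwX.aestronglyMeasurable _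
      (Filter.Eventually.of_forall fun ω => hwb _))
  have hV : MemLp (fun ω => (-lam) • stochGrad μ (X ω)) 2 P := hgX.const_smul (-lam)
  have hW : MemLp (fun ω => c • ξ ω) 2 P := hξL.const_smul c
  have hUV : MemLp (fun ω => w (X ω).1 • (θ ω - μ) + (-lam) • stochGrad μ (X ω)) 2 P := hU.add hV
  have e1 : ∀ ω, θ ω - lam • stochGrad (θ ω) (X ω) + c • ξ ω =
      (w (X ω).1 • (θ ω - μ) + (-lam) • stochGrad μ (X ω) + c • ξ ω) + μ := by
    intro ω
    rw [stochGrad_eq_add _ μ, hw]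
    module
  simp_rw [e1, add_sub_cancel_right]
  refine ⟨(hUV.add hW).add (memLp_const μ), ?_⟩
  -- the Gaussian noise is centred and independent of the other two terms
  have o1 : ∫ ω, inner ℝ (w (X ω).1 • (θ ω - μ) + (-lam) • stochGrad μ (X ω)) (c • ξ ω) ∂P = 0 := by
    have hφ : Measurable fun p : E d × ℝ × E d × E d =>
        w p.2.1 • (p.1 - μ) + (-lam) • stochGrad μ p.2 := by fun_prop
    have hi : IndepFun (fun ω => w (X ω).1 • (θ ω - μ) + (-lam) • stochGrad μ (X ω))
      (fun ω => c • ξ ω) P := h2.comp hφ (measurable_const_smul c)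
    rw [integral_inner_of_indepFun (hUV.integrable (by norm_num)) (hW.integrable (by norm_num)) hi,
      integral_smul, hξ.integral_eq]
    simp
  -- the random slope is moved to the factor which depends on the sample only
  have o2 : ∫ ω, inner ℝ (w (X ω).1 • (θ ω - μ)) ((-lam) • stochGrad μ (X ω)) ∂P = 0 := by
    have e2 : ∀ ω, inner ℝ (w (X ω).1 • (θ ω - μ)) ((-lam) • stochGrad μ (X ω)) =
        (-lam) * inner ℝ (θ ω - μ) (w (X ω).1 • stochGrad μ (X ω)) := by
      intro ω
      rw [real_inner_smul_left, real_inner_smul_right, real_inner_smul_right]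
      ring
    have hwg : MemLp (fun ω => w (X ω).1 • stochGrad μ (X ω)) 2 P :=
      hgX.smul (r := 2) (p := ⊤) (memLp_top_of_bound hwX.aestronglyMeasurable _
        (Filter.Eventually.of_forall fun ω => hwb _))
    have hψ : Measurable fun x : ℝ × E d × E d => w x.1 • stochGrad μ x := by fun_prop
    have hi : IndepFun (fun ω => θ ω - μ) (fun ω => w (X ω).1 • stochGrad μ (X ω)) P :=
      h1.comp (measurable_id.sub_const μ) hψ
    have h0 : ∫ ω, w (X ω).1 • stochGrad μ (X ω) ∂P = 0 :=
      (hX.integral_comp hψ.aestronglyMeasurable).trans (integral_smul_stochGrad_self hT μ hwm hwb)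
    simp_rw [e2]
    rw [integral_const_mul, integral_inner_of_indepFun (hΔ.integrable (by norm_num))
      (hwg.integrable (by norm_num)) hi, h0]
    simp
  rw [integral_norm_sq_add hUV hW o1, integral_norm_sq_add hU hV o2]
  have s1 : ∫ ω, ‖w (X ω).1 • (θ ω - μ)‖ ^ 2 ∂P =
      (1 - 4 * lam * moment2 T + 4 * lam ^ 2 * moment4 T) * ∫ ω, ‖θ ω - μ‖ ^ 2 ∂P := by
    simp_rw [norm_smul, mul_pow, Real.norm_eq_abs, sq_abs]
    rw [h1.symm.integral_fun_comp_mul_comp (f := fun x => w x.1 ^ 2) (g := fun y => ‖y - μ‖ ^ 2)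
      hXm.aemeasurable hθm.aemeasurable (Measurable.aestronglyMeasurable (by fun_prop))
      (Measurable.aestronglyMeasurable (by fun_prop)), ← integral_sq_one_sub_timeLaw hT]
    congr 1
    refine (hX.integral_comp (f := fun x => w x.1 ^ 2)
      (Measurable.aestronglyMeasurable (by fun_prop))).trans ?_
    unfold sampleLaw
    rw [integral_fun_fst (fun t => w t ^ 2)]
    simp [hw]
  have s2 : ∫ ω, ‖(-lam) • stochGrad μ (X ω)‖ ^ 2 ∂P ≤ 4 * lam ^ 2 * gradMoment T μ μ := by
    simp_rw [norm_smul, mul_pow, Real.norm_eq_abs, sq_abs, neg_sq]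
    rw [integral_const_mul, show ∫ ω, ‖stochGrad μ (X ω)‖ ^ 2 ∂P =
      ∫ x, ‖stochGrad μ x‖ ^ 2 ∂(sampleLaw T μ) from
        hX.integral_comp (f := fun x => ‖stochGrad μ x‖ ^ 2)
          (Measurable.aestronglyMeasurable (by fun_prop))]
    nlinarith [integral_norm_sq_stochGrad_le hT μ μ, sq_nonneg lam]
  have s3 : ∫ ω, ‖c • ξ ω‖ ^ 2 ∂P = c ^ 2 * d := by
    simp_rw [norm_smul, mul_pow, Real.norm_eq_abs, sq_abs]
    rw [integral_const_mul, ← integral_norm_sq_stdGaussian d]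
    congr 1
    exact hξ.integral_comp (f := fun x => ‖x‖ ^ 2) (by fun_prop)
  rw [s1, s3]
  linarith

/-! ### Independence of the Langevin iterates from later inputs -/

/-- The sequence which agrees with `x` up to the index `n` and is constant afterwards. -/
noncomputable def truncate {α : Type*} [Inhabited α] (n : ℕ) (x : ℕ → α) : ℕ → α :=
  fun i => if i ≤ n then x i else default

lemma indepFun_truncate {Ω α : Type*} [MeasurableSpace Ω] [MeasurableSpace α] [Inhabited α]
    {P : Measure Ω} {X : ℕ → Ω → α} (hX : ∀ i, Measurable (X i)) (h : iIndepFun X P) (n : ℕ) :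
    IndepFun (fun ω => truncate n (fun i => X i ω)) (X (n + 1)) P := by
  let φ : (Finset.range (n + 1) → α) → ℕ → α :=
    fun y i => if hi : i ∈ Finset.range (n + 1) then y ⟨i, hi⟩ else default
  have hφ : Measurable φ := by
    refine measurable_pi_lambda _ fun i => ?_
    simp only [φ]
    split_ifs <;> fun_prop
  have h1 := (h.indepFun_finset (Finset.range (n + 1)) {n + 1} (by simp) hX).comp hφ
    (measurable_pi_apply (⟨n + 1, by simp⟩ : ({n + 1} : Finset ℕ)))
  have e : (fun ω => truncate n (fun i => X i ω)) =
      φ ∘ fun ω (i : Finset.range (n + 1)) => X i ω := by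
    ext ω i
    simp [truncate, φ]
  rw [e]
  exact h1

lemma measurable_truncate {α : Type*} [MeasurableSpace α] [Inhabited α] (n : ℕ) :
    Measurable (truncate (α := α) n) := by
  refine measurable_pi_lambda _ fun i => ?_
  unfold truncate
  split_ifs <;> fun_prop

lemma sgld_congr {d : ℕ} (lam β : ℝ) (θ₀ : E d) {ξ ξ' : ℕ → E d} {x x' : ℕ → ℝ × E d × E d}
    {n : ℕ} (hξ : ∀ i ≤ n, ξ i = ξ' i) (hx : ∀ i ≤ n, x i = x' i) :
    sgld lam β θ₀ ξ x n = sgld lam β θ₀ ξ' x' n := by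
  induction n with
  | zero => rfl
  | succ n ih =>
    simp only [sgld]
    rw [ih (fun i hi => hξ i (by omega)) (fun i hi => hx i (by omega)), hξ _ le_rfl, hx _ le_rfl]

lemma sgld_truncate_right {d : ℕ} (lam β : ℝ) (θ₀ : E d) (ξ : ℕ → E d) (x : ℕ → ℝ × E d × E d)
    (n : ℕ) : sgld lam β θ₀ ξ (truncate n x) n = sgld lam β θ₀ ξ x n :=
  sgld_congr lam β θ₀ (fun _ _ => rfl) (fun i hi => by simp [truncate, hi])

lemma sgld_truncate_left {d : ℕ} (lam β : ℝ) (θ₀ : E d) (ξ : ℕ → E d) (x : ℕ → ℝ × E d × E d)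
    (n : ℕ) : sgld lam β θ₀ (truncate n ξ) x n = sgld lam β θ₀ ξ x n :=
  sgld_congr lam β θ₀ (fun i hi => by simp [truncate, hi]) (fun _ _ => rfl)

lemma measurable_sgld {d : ℕ} (lam β : ℝ) (n : ℕ) :
    Measurable (fun p : E d × (ℕ → E d) × (ℕ → ℝ × E d × E d) =>
      sgld lam β p.1 p.2.1 p.2.2 n) := by
  induction n with
  | zero => exact measurable_fst
  | succ n ih =>
    simp only [sgld]
    have h : Measurable (fun p : E d × (ℕ → E d) × (ℕ → ℝ × E d × E d) =>
        stochGrad (sgld lam β p.1 p.2.1 p.2.2 n) (p.2.2 (n + 1))) :=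
      ih.stochGrad (by fun_prop)
    exact (ih.sub (h.const_smul lam)).add
      (Measurable.const_smul (by fun_prop) (Real.sqrt (2 * lam / β)))

section

variable {d : ℕ} {Ω : Type*} [MeasurableSpace Ω] {P : Measure Ω} [IsProbabilityMeasure P]
  {θ₀ : Ω → E d} {ξ : ℕ → Ω → E d} {X : ℕ → Ω → ℝ × E d × E d}

/-- The `n`-th iterate only uses the data up to the index `n`, hence is independent of the next
sample. -/
lemma indepFun_sgld_data (hθ₀ : Measurable θ₀) (hξ : ∀ i, Measurable (ξ i))
    (hX : ∀ i, Measurable (X i)) (hX_indep : iIndepFun X P)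
    (h₀ : IndepFun θ₀ (fun ω => (fun i => ξ i ω, fun i => X i ω)) P)
    (h : IndepFun (fun ω i => ξ i ω) (fun ω i => X i ω) P) (lam β : ℝ) (n : ℕ) :
    IndepFun (fun ω => sgld lam β (θ₀ ω) (fun i => ξ i ω) (fun i => X i ω) n) (X (n + 1)) P := by
  have ht := measurable_truncate (α := ℝ × E d × E d) n
  have hξX : IndepFun (fun ω => ((fun i => ξ i ω), truncate n (fun i => X i ω))) (X (n + 1)) P :=
    indepFun_prodMk_left (by fun_prop) (by fun_prop) (hX _)
      (h.comp (φ := id) (ψ := fun x => (truncate n x, x (n + 1))) measurable_id (by fun_prop))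
      (indepFun_truncate hX hX_indep n)
  have hψ : Measurable fun p : (ℕ → E d) × (ℕ → ℝ × E d × E d) =>
      ((p.1, truncate n p.2), p.2 (n + 1)) := by fun_prop
  have h3 : IndepFun (fun ω => (θ₀ ω, (fun i => ξ i ω), truncate n (fun i => X i ω)))
      (X (n + 1)) P :=
    indepFun_prodMk_left hθ₀ (by fun_prop) (hX _) (h₀.comp measurable_id hψ) hξX
  have h4 := h3.comp (measurable_sgld lam β n) measurable_id
  simpa only [Function.comp_def, sgld_truncate_right, id] using h4

lemma indepFun_sgld_data_noise (hθ₀ : Measurable θ₀) (hξ : ∀ i, Measurable (ξ i))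
    (hX : ∀ i, Measurable (X i)) (hξ_indep : iIndepFun ξ P)
    (h₀ : IndepFun θ₀ (fun ω => (fun i => ξ i ω, fun i => X i ω)) P)
    (h : IndepFun (fun ω i => ξ i ω) (fun ω i => X i ω) P) (lam β : ℝ) (n : ℕ) :
    IndepFun (fun ω => (sgld lam β (θ₀ ω) (fun i => ξ i ω) (fun i => X i ω) n, X (n + 1) ω))
      (ξ (n + 1)) P := by
  have ht := measurable_truncate (α := E d) n
  have hξX : IndepFun (fun ω => ((fun i => X i ω), truncate n (fun i => ξ i ω))) (ξ (n + 1)) P :=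
    indepFun_prodMk_left (by fun_prop) (by fun_prop) (hξ _)
      (h.symm.comp (φ := id) (ψ := fun x => (truncate n x, x (n + 1))) measurable_id
        (by fun_prop))
      (indepFun_truncate hξ hξ_indep n)
  have hψ : Measurable fun p : (ℕ → E d) × (ℕ → ℝ × E d × E d) =>
      ((p.2, truncate n p.1), p.1 (n + 1)) := by fun_prop
  have h3 : IndepFun (fun ω => (θ₀ ω, (fun i => X i ω), truncate n (fun i => ξ i ω)))
      (ξ (n + 1)) P :=
    indepFun_prodMk_left hθ₀ (by fun_prop) (hξ _) (h₀.comp measurable_id hψ) hξX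
  have hswap : Measurable fun p : E d × (ℕ → ℝ × E d × E d) × (ℕ → E d) =>
      (p.1, p.2.2, p.2.1) := by fun_prop
  have hF : Measurable fun p : E d × (ℕ → ℝ × E d × E d) × (ℕ → E d) =>
      (sgld lam β p.1 p.2.2 p.2.1 n, p.2.1 (n + 1)) :=
    ((measurable_sgld lam β n).comp hswap).prodMk (by fun_prop)
  have h4 := h3.comp hF measurable_id
  simpa only [Function.comp_def, sgld_truncate_left, id] using h4

end

/-! ### Convergence of the Langevin iterates -/

lemma moment4_nonneg (T : ℝ) : 0 ≤ moment4 T :=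
  integral_nonneg fun t => by positivity

lemma gradMoment_nonneg {d : ℕ} (T : ℝ) (μ θ : E d) : 0 ≤ gradMoment T μ θ := by
  rw [← integral_gradBound_sq]
  exact integral_nonneg fun x => sq_nonneg _

lemma moment2_pos_of_lt_lamMax {T lam : ℝ} (h0 : 0 < lam) (h : lam ≤ lamMax T) :
    0 < moment2 T := by
  have h1 : 0 < 1 / (2 * moment2 T) := h0.trans_le (h.trans (min_le_right _ _))
  have := one_div_pos.1 h1
  linarith

lemma two_mul_lam_mul_moment2_le_one {T lam : ℝ} (h0 : 0 < lam) (h : lam ≤ lamMax T) :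
    2 * lam * moment2 T ≤ 1 := by
  have ha := moment2_pos_of_lt_lamMax h0 h
  have h1 : lam ≤ 1 / (2 * moment2 T) := h.trans (min_le_right _ _)
  rw [le_div_iff₀ (by positivity)] at h1
  linarith

lemma four_mul_lam_mul_moment4_le {T lam : ℝ} (h0 : 0 < lam) (h : lam ≤ lamMax T) :
    4 * lam * moment4 T ≤ moment2 T := by
  have h1 : lam ≤ moment2 T / (4 * moment4 T) := h.trans (min_le_left _ _)
  -- if `moment4 T = 0`, division by zero turns `lam ≤ lamMax T` into `lam ≤ 0`
  rcases (moment4_nonneg T).eq_or_lt with hb | hb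
  · rw [← hb] at h1
    simp only [mul_zero, div_zero] at h1
    linarith
  · rw [le_div_iff₀ (by positivity)] at h1
    linarith

/-- The mean square error contracts at rate `2 λ E[σ_τ ^ 2 m_τ ^ 2]` per step, up to the stationary
contributions of the Gaussian noise and of the stochastic gradient. -/
lemma sgld_memLp_and_error_le {d : ℕ} {T : ℝ} (hT : 0 < T) (μ : E d) {Ω : Type*}
    [MeasurableSpace Ω] {P : Measure Ω} [IsProbabilityMeasure P]
    {θ₀ : Ω → E d} {ξ : ℕ → Ω → E d} {X : ℕ → Ω → ℝ × E d × E d}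
    (hθ₀ : Measurable θ₀) (hξ : ∀ i, Measurable (ξ i)) (hX : ∀ i, Measurable (X i))
    (hθ₀_memLp : MemLp θ₀ 2 P)
    (hξ_law : ∀ i, HasLaw (ξ i) (stdGaussian (E d)) P) (hξ_indep : iIndepFun ξ P)
    (hX_law : ∀ i, HasLaw (X i) (sampleLaw T μ) P) (hX_indep : iIndepFun X P)
    (h₀ : IndepFun θ₀ (fun ω => (fun i => ξ i ω, fun i => X i ω)) P)
    (h : IndepFun (fun ω i => ξ i ω) (fun ω i => X i ω) P) {lam β : ℝ} (hlam0 : 0 < lam)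
    (hlam : lam ≤ lamMax T) (hβ : 0 < β) (n : ℕ) :
    MemLp (fun ω => sgld lam β (θ₀ ω) (fun i => ξ i ω) (fun i => X i ω) n) 2 P ∧
    ∫ ω, ‖sgld lam β (θ₀ ω) (fun i => ξ i ω) (fun i => X i ω) n - μ‖ ^ 2 ∂P ≤
      Real.exp (-(2 * (n * lam * moment2 T))) * ∫ ω, ‖θ₀ ω - μ‖ ^ 2 ∂P +
        (d * CSGLD1 T / β + lam * CSGLD2 T μ μ) := by
  have ha := moment2_pos_of_lt_lamMax hlam0 hlam
  have hG := gradMoment_nonneg T μ μ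
  have hR : 0 ≤ d * CSGLD1 T / β + lam * CSGLD2 T μ μ := by
    unfold CSGLD1 CSGLD2
    positivity
  induction n with
  | zero =>
    simp only [sgld]
    exact ⟨hθ₀_memLp, by simpa using hR⟩
  | succ n ih =>
    obtain ⟨ihL, ih⟩ := ih
    have hmeas : Measurable fun ω => sgld lam β (θ₀ ω) (fun i => ξ i ω) (fun i => X i ω) n :=
      (measurable_sgld lam β n).comp
        (hθ₀.prodMk ((measurable_pi_lambda _ hξ).prodMk (measurable_pi_lambda _ hX)))
    obtain ⟨hL, hstep⟩ := sgld_step hT μ lam (Real.sqrt (2 * lam / β)) ihL hmeas (hX _) (hξ_law _)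
      (hX_law (n + 1)) (indepFun_sgld_data hθ₀ hξ hX hX_indep h₀ h lam β n)
      (indepFun_sgld_data_noise hθ₀ hξ hX hξ_indep h₀ h lam β n)
    refine ⟨hL, hstep.trans ?_⟩
    set D := ∫ ω, ‖sgld lam β (θ₀ ω) (fun i => ξ i ω) (fun i => X i ω) n - μ‖ ^ 2 ∂P
    set D₀ := ∫ ω, ‖θ₀ ω - μ‖ ^ 2 ∂P
    set R := d * CSGLD1 T / β + lam * CSGLD2 T μ μ with hRdef
    have hD : 0 ≤ D := integral_nonneg fun ω => by positivity
    have hD₀ : 0 ≤ D₀ := integral_nonneg fun ω => by positivity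
    rw [Real.sq_sqrt (by positivity)]
    have h1 := two_mul_lam_mul_moment2_le_one hlam0 hlam
    have h2 := four_mul_lam_mul_moment4_le hlam0 hlam
    -- the two noise terms are at most `2 λ E[σ_τ ^ 2 m_τ ^ 2] R`
    have hB : 4 * lam ^ 2 * gradMoment T μ μ + 2 * lam / β * d ≤ 2 * lam * moment2 T * R := by
      have : 2 * lam * moment2 T * R = 8 * lam ^ 2 * gradMoment T μ μ + 2 * lam / β * d := by
        rw [hRdef, CSGLD1, CSGLD2]
        field_simp
        ring
      rw [this]
      nlinarith [mul_nonneg (sq_nonneg lam) hG]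
    have hF : 1 - 4 * lam * moment2 T + 4 * lam ^ 2 * moment4 T ≤ 1 - 2 * lam * moment2 T := by
      nlinarith [mul_pos hlam0 ha]
    have hexp : 1 - 2 * lam * moment2 T ≤ Real.exp (-(2 * lam * moment2 T)) := by
      linarith [Real.add_one_le_exp (-(2 * lam * moment2 T))]
    have hsplit : Real.exp (-(2 * ((n + 1 : ℕ) * lam * moment2 T))) =
        Real.exp (-(2 * lam * moment2 T)) * Real.exp (-(2 * (n * lam * moment2 T))) := by
      rw [← Real.exp_add]
      push_cast
      ring_nf
    rw [hsplit]
    set e := Real.exp (-(2 * (n * lam * moment2 T)))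
    have he : 0 ≤ e * D₀ := mul_nonneg (Real.exp_pos _).le hD₀
    calc (1 - 4 * lam * moment2 T + 4 * lam ^ 2 * moment4 T) * D +
          4 * lam ^ 2 * gradMoment T μ μ + 2 * lam / β * d
        ≤ (1 - 2 * lam * moment2 T) * D + 2 * lam * moment2 T * R := by
          linarith [mul_le_mul_of_nonneg_right hF hD]
      _ ≤ (1 - 2 * lam * moment2 T) * (e * D₀ + R) + 2 * lam * moment2 T * R := by
          gcongr
      _ = (1 - 2 * lam * moment2 T) * (e * D₀) + R := by ring
      _ ≤ Real.exp (-(2 * lam * moment2 T)) * (e * D₀) + R := by gcongr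
      _ = _ := by ring

/-! ### The Euler-Maruyama scheme -/

/-- The coefficient of the parameter `θ` in the `k`-th Euler-Maruyama iterate. -/
noncomputable def emCoeff (γ T : ℝ) : ℕ → ℝ
  | 0 => 0
  | k + 1 => (1 - γ) * emCoeff γ T k + 2 * γ * m (T - k * γ)

/-- The variance of each coordinate of the `k`-th Euler-Maruyama iterate with parameter `0`. -/
noncomputable def emVar (γ : ℝ) : ℕ → ℝ
  | 0 => 1
  | k + 1 => (1 - γ) ^ 2 * emVar γ k + 2 * γ

lemma eulerMaruyama_eq {d : ℕ} (γ T : ℝ) (θ y : E d) (z : ℕ → E d) (k : ℕ) :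
    eulerMaruyama γ T θ y z k = emCoeff γ T k • θ + eulerMaruyama γ T 0 y z k := by
  induction k with
  | zero => simp [eulerMaruyama, emCoeff]
  | succ k ih =>
    simp only [eulerMaruyama, emCoeff, score, smul_zero]
    rw [ih]
    module

lemma eulerMaruyama_zero_succ {d : ℕ} (γ T : ℝ) (y : E d) (z : ℕ → E d) (k : ℕ) :
    eulerMaruyama γ T 0 y z (k + 1) =
      (1 - γ) • eulerMaruyama γ T 0 y z k + Real.sqrt (2 * γ) • z (k + 1) := by
  simp only [eulerMaruyama, score, smul_zero]
  module

lemma one_le_emVar (γ : ℝ) (k : ℕ) : 1 ≤ emVar γ k := by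
  induction k with
  | zero => exact le_rfl
  | succ k ih =>
    simp only [emVar]
    nlinarith [mul_le_mul_of_nonneg_left ih (sq_nonneg (1 - γ)), sq_nonneg γ]

lemma emVar_le {γ : ℝ} (h0 : 0 < γ) (h1 : γ < 1) (k : ℕ) : emVar γ k ≤ 1 + γ := by
  induction k with
  | zero => simp [emVar, h0.le]
  | succ k ih =>
    simp only [emVar]
    have : (1 - γ) ^ 2 * (1 + γ) + 2 * γ ≤ 1 + γ := by nlinarith [mul_pos h0 h0]
    linarith [mul_le_mul_of_nonneg_left ih (sq_nonneg (1 - γ))]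

/-- The sequence `m (T - k γ)` is a supersolution of the recursion for `emCoeff`, because
`1 + γ ≤ e^γ`. -/
lemma emCoeff_le {γ : ℝ} (h1 : γ < 1) (T : ℝ) (k : ℕ) :
    emCoeff γ T k ≤ m (T - k * γ) := by
  induction k with
  | zero => exact (m_pos _).le
  | succ k ih =>
    have hm : m (T - (k + 1 : ℕ) * γ) = Real.exp γ * m (T - k * γ) := by
      rw [m, m, ← Real.exp_add]
      push_cast
      ring_nf
    rw [hm, emCoeff]
    have h2 := mul_le_mul_of_nonneg_right (Real.add_one_le_exp γ) (m_pos (T - k * γ)).le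
    have h3 := mul_le_mul_of_nonneg_left ih (sub_nonneg.2 h1.le)
    linarith

/-- A subsolution of the recursion for `emCoeff` which vanishes at `k = 0`; the factor `1 - γ`
absorbs the error of the expansion `e^γ ≤ 1 + γ + γ ^ 2`. -/
lemma le_emCoeff {γ : ℝ} (h0 : 0 < γ) (h1 : γ < 1) (T : ℝ) (k : ℕ) :
    (1 - γ) * (m (T - k * γ) - (1 - γ) ^ k * m T) ≤ emCoeff γ T k := by
  induction k with
  | zero => simp [emCoeff]
  | succ k ih =>
    have hm : m (T - (k + 1 : ℕ) * γ) = Real.exp γ * m (T - k * γ) := by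
      rw [m, m, ← Real.exp_add]
      push_cast
      ring_nf
    rw [hm, emCoeff]
    have he : Real.exp γ ≤ 1 + γ + γ ^ 2 := by
      have := Real.abs_exp_sub_one_sub_id_le (x := γ) (by rw [abs_of_pos h0]; exact h1.le)
      linarith [le_abs_self (Real.exp γ - 1 - γ)]
    have h3 := mul_le_mul_of_nonneg_left ih (sub_nonneg.2 h1.le)
    have h4 : (1 - γ) * Real.exp γ ≤ (1 - γ) ^ 2 + 2 * γ := by
      nlinarith [mul_le_mul_of_nonneg_left he (sub_nonneg.2 h1.le), mul_pos h0 h0,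
        mul_pos (mul_pos h0 h0) h0]
    have h5 := mul_le_mul_of_nonneg_right h4 (m_pos (T - k * γ)).le
    rw [pow_succ]
    nlinarith

lemma emCoeff_nonneg {γ : ℝ} (h0 : 0 < γ) (h1 : γ < 1) (T : ℝ) (k : ℕ) : 0 ≤ emCoeff γ T k := by
  induction k with
  | zero => exact le_rfl
  | succ k ih =>
    rw [emCoeff]
    have := m_pos (T - k * γ)
    have := mul_nonneg (sub_nonneg.2 h1.le) ih
    positivity

lemma emCoeff_final_le_one {γ T : ℝ} (h1 : γ < 1) {K : ℕ} (hT : T = (K + 1) * γ) :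
    emCoeff γ T (K + 1) ≤ 1 := by
  refine (emCoeff_le h1 T (K + 1)).trans_eq ?_
  simp [hT, m]

lemma one_sub_emCoeff_final_le {γ T : ℝ} (h0 : 0 < γ) (h1 : γ < 1) {K : ℕ}
    (hT : T = (K + 1) * γ) : 1 - emCoeff γ T (K + 1) ≤ γ + Real.exp (-T) := by
  have h := le_emCoeff h0 h1 T (K + 1)
  have hm : m (T - (K + 1 : ℕ) * γ) = 1 := by simp [hT, m]
  rw [hm] at h
  have h2 : (1 - γ) ^ (K + 1) ≤ 1 := pow_le_one₀ (by linarith) (by linarith)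
  have h3 : 0 ≤ (1 - γ) ^ (K + 1) := pow_nonneg (by linarith) _
  have h4 : (1 - γ) ^ (K + 1) * m T ≤ m T := by
    have := mul_le_mul_of_nonneg_right h2 (m_pos T).le
    linarith
  have h5 : (1 - γ) * ((1 - γ) ^ (K + 1) * m T) ≤ m T := by
    nlinarith [mul_nonneg h3 (m_pos T).le]
  have h6 : m T = Real.exp (-T) := rfl
  linarith

lemma eulerMaruyama_truncate {d : ℕ} (γ T : ℝ) (θ y : E d) (z : ℕ → E d) {k n : ℕ} (h : k ≤ n) :
    eulerMaruyama γ T θ y (truncate n z) k = eulerMaruyama γ T θ y z k := by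
  induction k with
  | zero => rfl
  | succ k ih => simp only [eulerMaruyama, ih (by omega), truncate, h, if_true]

lemma measurable_eulerMaruyama {d : ℕ} (γ T : ℝ) (θ : E d) (k : ℕ) :
    Measurable (fun p : E d × (ℕ → E d) => eulerMaruyama γ T θ p.1 p.2 k) := by
  induction k with
  | zero => exact measurable_fst
  | succ k ih =>
    simp only [eulerMaruyama, score]
    fun_prop

/-- With parameter `0`, the iterates of the scheme are centred Gaussian vectors with covariance
`emVar γ k` times the identity. -/
lemma hasLaw_eulerMaruyama_zero {d : ℕ} {Ω : Type*} [MeasurableSpace Ω] {P : Measure Ω}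
    [IsProbabilityMeasure P] {Y₀ : Ω → E d} {Z : ℕ → Ω → E d} (hY₀ : Measurable Y₀)
    (hZ : ∀ k, Measurable (Z k)) (hY₀_law : HasLaw Y₀ (stdGaussian (E d)) P)
    (hZ_law : ∀ k, HasLaw (Z k) (stdGaussian (E d)) P) (hZ_indep : iIndepFun Z P)
    (h : IndepFun Y₀ (fun ω k => Z k ω) P) {γ : ℝ} (hγ : 0 < γ) (T : ℝ) (k : ℕ) :
    HasLaw (fun ω => (Real.sqrt (emVar γ k))⁻¹ •
      eulerMaruyama γ T 0 (Y₀ ω) (fun i => Z i ω) k) (stdGaussian (E d)) P := by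
  induction k with
  | zero => simpa [emVar, eulerMaruyama] using hY₀_law
  | succ k ih =>
    have hψ : Measurable fun z : ℕ → E d => (truncate k z, z (k + 1)) :=
      (measurable_truncate k).prodMk (measurable_pi_apply _)
    have h1 : IndepFun (fun ω => (Y₀ ω, truncate k (fun i => Z i ω))) (Z (k + 1)) P :=
      indepFun_prodMk_left hY₀ ((measurable_truncate k).comp (measurable_pi_lambda _ hZ)) (hZ _)
        (h.comp measurable_id hψ) (indepFun_truncate hZ hZ_indep k)
    have h2 := h1.comp ((measurable_eulerMaruyama γ T 0 k).const_smul
      ((Real.sqrt (emVar γ k))⁻¹)) measurable_id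
    have h3 : IndepFun (fun ω => (Real.sqrt (emVar γ k))⁻¹ •
        eulerMaruyama γ T 0 (Y₀ ω) (fun i => Z i ω) k) (Z (k + 1)) P := by
      simpa only [Function.comp_def, Pi.smul_apply, eulerMaruyama_truncate _ _ _ _ _ le_rfl, id]
        using h2
    have hv : 0 < emVar γ k := by linarith [one_le_emVar γ k]
    have hv' : 0 < emVar γ (k + 1) := by linarith [one_le_emVar γ (k + 1)]
    have hab : ((Real.sqrt (emVar γ (k + 1)))⁻¹ * (1 - γ) * Real.sqrt (emVar γ k)) ^ 2 +
        ((Real.sqrt (emVar γ (k + 1)))⁻¹ * Real.sqrt (2 * γ)) ^ 2 = 1 := by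
      rw [mul_pow, mul_pow, mul_pow, inv_pow, Real.sq_sqrt hv.le, Real.sq_sqrt hv'.le,
        Real.sq_sqrt (by positivity), mul_assoc, ← mul_add, inv_mul_eq_one₀ hv'.ne', emVar]
    have h4 := hasLaw_stdGaussian_add ih (hZ_law (k + 1)) h3 hab
    convert h4 using 2 with ω
    rw [eulerMaruyama_zero_succ, smul_add, smul_smul, smul_smul, smul_smul]
    congr 2
    have : Real.sqrt (emVar γ k) ≠ 0 := by positivity
    field_simp

/-! ### The coupling -/

/-- The Wasserstein distance of the laws of two random vectors on a common probability space is at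
most their distance in `L ^ 2`. -/
lemma W2_map_le_eLpNorm {d : ℕ} {Ω : Type*} [MeasurableSpace Ω] {P : Measure Ω}
    [IsProbabilityMeasure P] {U V : Ω → E d} (hU : Measurable U) (hV : Measurable V) :
    W2 (P.map U) (P.map V) ≤ eLpNorm (fun ω => U ω - V ω) 2 P := by
  rw [eLpNorm_eq_lintegral_rpow_enorm_toReal (by norm_num) (by norm_num)]
  unfold W2
  simp only [ENNReal.toReal_ofNat, ENNReal.rpow_ofNat]
  gcongr
  refine (iInf₂_le (P.map fun ω => (U ω, V ω)) ⟨Measure.isProbabilityMeasure_map (by fun_prop),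
    Measure.fst_map_prodMk hV, Measure.snd_map_prodMk hU⟩).trans_eq ?_
  rw [lintegral_map (by fun_prop) (by fun_prop)]

lemma eLpNorm_two_eq_ofReal_sqrt {d : ℕ} {Ω : Type*} [MeasurableSpace Ω] {P : Measure Ω}
    {U : Ω → E d} (hU : MemLp U 2 P) :
    eLpNorm U 2 P = ENNReal.ofReal (Real.sqrt (∫ ω, ‖U ω‖ ^ 2 ∂P)) := by
  rw [hU.eLpNorm_eq_integral_rpow_norm (by norm_num) (by norm_num), Real.sqrt_eq_rpow]
  simp

/-- For a random parameter independent of the driving noise, the output of the scheme is close to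
`N(μ, I_d)` in the Wasserstein distance: the affine dependence on the parameter and the Gaussian
noise part are compared separately, the latter by rescaling it to unit variance. -/
lemma W2_eulerMaruyama_le {d : ℕ} (μ : E d) {T γ : ℝ} {K : ℕ} (hγ0 : 0 < γ) (hγ1 : γ < 1)
    (hT : T = (K + 1) * γ) {Ω₁ : Type*} [MeasurableSpace Ω₁] {P₁ : Measure Ω₁}
    [IsProbabilityMeasure P₁] {θ : Ω₁ → E d} (hθ : Measurable θ) (hθL : MemLp θ 2 P₁)
    {Ω₂ : Type*} [MeasurableSpace Ω₂] {P₂ : Measure Ω₂} [IsProbabilityMeasure P₂]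
    {Y₀ : Ω₂ → E d} {Z : ℕ → Ω₂ → E d} (hY₀ : Measurable Y₀)
    (hZ : ∀ k, Measurable (Z k)) (hY₀_law : HasLaw Y₀ (stdGaussian (E d)) P₂)
    (hZ_law : ∀ k, HasLaw (Z k) (stdGaussian (E d)) P₂) (hZ_indep : iIndepFun Z P₂)
    (h : IndepFun Y₀ (fun ω k => Z k ω) P₂) :
    W2 ((P₁.prod P₂).map (fun ω => eulerMaruyama γ T (θ ω.1) (Y₀ ω.2) (fun k => Z k ω.2) (K + 1)))
      (dataLaw μ) ≤ ENNReal.ofReal (Real.sqrt (∫ ω, ‖θ ω - μ‖ ^ 2 ∂P₁) +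
        (γ + Real.exp (-T)) * ‖μ‖ + γ * Real.sqrt d) := by
  set A := emCoeff γ T (K + 1)
  set s := Real.sqrt (emVar γ (K + 1)) with hs
  set N : Ω₂ → E d := fun ω => s⁻¹ • eulerMaruyama γ T 0 (Y₀ ω) (fun i => Z i ω) (K + 1) with hN
  have hNlaw : HasLaw N (stdGaussian (E d)) P₂ :=
    hasLaw_eulerMaruyama_zero hY₀ hZ hY₀_law hZ_law hZ_indep h hγ0 T (K + 1)
  have hs1 : 1 ≤ s := Real.one_le_sqrt.2 (one_le_emVar γ _)
  have hsγ : s ≤ 1 + γ := by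
    refine (Real.sqrt_le_sqrt (emVar_le hγ0 hγ1 _)).trans ?_
    rw [Real.sqrt_le_left (by linarith)]
    nlinarith
  have hNm : Measurable N :=
    ((measurable_eulerMaruyama γ T 0 (K + 1)).comp
      (hY₀.prodMk (measurable_pi_lambda _ hZ))).const_smul s⁻¹
  have eY : (fun ω : Ω₁ × Ω₂ =>
      eulerMaruyama γ T (θ ω.1) (Y₀ ω.2) (fun k => Z k ω.2) (K + 1)) =
      fun ω => A • θ ω.1 + s • N ω.2 := by
    ext1 ω
    rw [eulerMaruyama_eq, hN, smul_inv_smul₀ (by positivity)]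
  have eμ : dataLaw μ = (P₁.prod P₂).map (fun ω => μ + N ω.2) := by
    have hcomp := measurePreserving_snd (μ := P₁) (ν := P₂)
    rw [dataLaw_eq_map, ← hNlaw.map_eq, Measure.map_map (by fun_prop) hNm]
    conv_lhs => rw [← hcomp.map_eq]
    rw [Measure.map_map (by fun_prop) (by fun_prop)]
    rfl
  have hNL : MemLp N 2 P₂ := hNlaw.hasGaussianLaw.memLp_two
  rw [eY, eμ]
  refine (W2_map_le_eLpNorm (by fun_prop) (by fun_prop)).trans ?_
  have hsplit : (fun ω : Ω₁ × Ω₂ => A • θ ω.1 + s • N ω.2 - (μ + N ω.2)) =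
      (fun ω : Ω₁ × Ω₂ => A • (θ ω.1 - μ)) + (fun _ => (A - 1) • μ) +
        fun ω : Ω₁ × Ω₂ => (s - 1) • N ω.2 := by
    ext1 ω
    simp only [Pi.add_apply]
    module
  have l1 : eLpNorm (fun ω : Ω₁ × Ω₂ => A • (θ ω.1 - μ)) 2 (P₁.prod P₂) ≤
      ENNReal.ofReal (Real.sqrt (∫ ω, ‖θ ω - μ‖ ^ 2 ∂P₁)) := by
    have hΔ : MemLp (fun ω => θ ω - μ) 2 P₁ := hθL.sub (memLp_const μ)
    have e : eLpNorm (fun ω : Ω₁ × Ω₂ => θ ω.1 - μ) 2 (P₁.prod P₂) =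
        eLpNorm (fun ω => θ ω - μ) 2 P₁ :=
      eLpNorm_comp_measurePreserving hΔ.1 measurePreserving_fst
    rw [← eLpNorm_two_eq_ofReal_sqrt hΔ, ← e]
    refine eLpNorm_mono fun ω => ?_
    rw [norm_smul, Real.norm_of_nonneg (emCoeff_nonneg hγ0 hγ1 _ _)]
    exact mul_le_of_le_one_left (norm_nonneg _) (emCoeff_final_le_one hγ1 hT)
  have l2 : eLpNorm (fun _ : Ω₁ × Ω₂ => (A - 1) • μ) 2 (P₁.prod P₂) ≤
      ENNReal.ofReal ((γ + Real.exp (-T)) * ‖μ‖) := by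
    rw [eLpNorm_const _ (by norm_num) (IsProbabilityMeasure.ne_zero _)]
    simp only [measure_univ, ENNReal.one_rpow, mul_one]
    rw [← ofReal_norm, norm_smul, Real.norm_of_nonpos
      (sub_nonpos.2 (emCoeff_final_le_one hγ1 hT)), neg_sub]
    gcongr
    exact one_sub_emCoeff_final_le hγ0 hγ1 hT
  have l3 : eLpNorm (fun ω : Ω₁ × Ω₂ => (s - 1) • N ω.2) 2 (P₁.prod P₂) ≤
      ENNReal.ofReal (γ * Real.sqrt d) := by
    have hsN : MemLp (fun ω => (s - 1) • N ω) 2 P₂ := hNL.const_smul (s - 1)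
    have e : eLpNorm (fun ω : Ω₁ × Ω₂ => (s - 1) • N ω.2) 2 (P₁.prod P₂) =
        eLpNorm (fun ω => (s - 1) • N ω) 2 P₂ :=
      eLpNorm_comp_measurePreserving hsN.1 measurePreserving_snd
    rw [e, eLpNorm_two_eq_ofReal_sqrt hsN]
    apply ENNReal.ofReal_le_ofReal
    have e2 : ∫ ω, ‖(s - 1) • N ω‖ ^ 2 ∂P₂ = (s - 1) ^ 2 * d := by
      simp_rw [norm_smul, mul_pow, Real.norm_eq_abs, sq_abs]
      rw [integral_const_mul, ← integral_norm_sq_stdGaussian d]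
      congr 1
      exact hNlaw.integral_comp (f := fun x => ‖x‖ ^ 2) (by fun_prop)
    rw [e2, Real.sqrt_mul (sq_nonneg _), Real.sqrt_sq (by linarith)]
    gcongr
    linarith
  rw [hsplit]
  refine (eLpNorm_add_le (Measurable.aestronglyMeasurable (by fun_prop))
    (Measurable.aestronglyMeasurable (by fun_prop)) (by norm_num)).trans ?_
  refine (add_le_add_left (eLpNorm_add_le (Measurable.aestronglyMeasurable (by fun_prop))
    (Measurable.aestronglyMeasurable (by fun_prop)) (by norm_num)) _).trans ?_
  refine (add_le_add (add_le_add l1 l2) l3).trans_eq ?_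
  rw [← ENNReal.ofReal_add (by positivity) (by positivity),
    ← ENNReal.ofReal_add (by positivity) (by positivity)]

/-! ### The choice of the parameters -/

lemma one_le_c0 : 1 ≤ c0 := by
  unfold c0
  have : 1 ≤ Real.sqrt (4 / 3) := Real.one_le_sqrt.2 (by norm_num)
  linarith [Real.sqrt_nonneg 33]

/-- The three groups of terms of the error bound are at most `δ / 4`, `δ / 4` and `3 δ / 8`, where
the last fraction comes from `√a + √b ≤ √2 √(a + b) ≤ 3/2 √(a + b)`. -/
lemma error_bound_lt {d : ℕ} (hd : 1 ≤ d) (μ : E d) {T γ lam β v δ : ℝ} {n : ℕ} (hγ0 : 0 < γ)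
    (hlam0 : 0 < lam) (ha : 0 < moment2 T) (hβ0 : 0 < β) (hv : 0 ≤ v) (hδ : 0 < δ)
    (hT : Tdelta μ δ < T) (hβ : betaDelta d T δ ≤ β) (hlam : lam ≤ lamDelta T μ μ δ)
    (hn : nDelta T lam v δ ≤ n) (hγ : γ < gammaDelta μ δ) :
    2 * Real.exp (-T) * (Real.sqrt (dataSecondMoment μ) + Real.sqrt (3 * d / 2)) +
        (Real.sqrt (4 / 3) + 2 * Real.sqrt 33) *
          (Real.exp (-(n * lam * moment2 T)) * Real.sqrt v +
            Real.sqrt (d * CSGLD1 T / β) + Real.sqrt (lam * CSGLD2 T μ μ)) +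
        γ * (Real.sqrt (18 * d) + Real.sqrt (132 * ‖μ‖ ^ 2)) < δ := by
  have hc : 0 < c0 := by linarith [one_le_c0]
  have hd' : (1 : ℝ) ≤ d := by exact_mod_cast hd
  change _ + c0 * _ + _ < δ
  have t1 : 2 * Real.exp (-T) * (Real.sqrt (dataSecondMoment μ) + Real.sqrt (3 * d / 2)) <
      δ / 4 := by
    have hS : 0 < Real.sqrt (dataSecondMoment μ) + Real.sqrt (3 * d / 2) := by positivity
    set S := Real.sqrt (dataSecondMoment μ) + Real.sqrt (3 * d / 2) with hSdef
    rw [Tdelta, ← hSdef, Real.log_lt_iff_lt_exp (by positivity), div_lt_iff₀ hδ] at hT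
    rw [Real.exp_neg]
    have := Real.exp_pos T
    field_simp
    linarith
  have t2 : Real.exp (-(n * lam * moment2 T)) * Real.sqrt v ≤ δ / (12 * c0) := by
    -- for `v = 0` the hypothesis on `n` carries no information, and none is needed
    rcases hv.eq_or_lt with hv | hv
    · rw [← hv, Real.sqrt_zero, mul_zero]
      positivity
    · have hsv : 0 < Real.sqrt v := Real.sqrt_pos.2 hv
      rw [nDelta, inv_mul_le_iff₀ (by positivity), Real.log_le_iff_le_exp (by positivity),
        div_le_iff₀ hδ] at hn
      rw [Real.exp_neg, show (n : ℝ) * lam * moment2 T = lam * moment2 T * n by ring]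
      have := Real.exp_pos (lam * moment2 T * n)
      field_simp
      linarith
  have t3 : Real.sqrt (d * CSGLD1 T / β) ≤ δ / (12 * c0) := by
    apply Real.sqrt_le_iff.2 ⟨by positivity, ?_⟩
    have hk : ∫ t, kappa t * m t ^ 2 ∂(timeLaw T) = moment2 T := rfl
    rw [betaDelta, hk, div_le_iff₀ (by positivity)] at hβ
    rw [CSGLD1, div_le_iff₀ hβ0, div_pow]
    field_simp
    linarith
  have t4 : Real.sqrt (lam * CSGLD2 T μ μ) ≤ δ / (12 * c0) := by
    apply Real.sqrt_le_iff.2 ⟨by positivity, ?_⟩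
    have h1 := hlam.trans (min_le_right _ _)
    -- for a vanishing gradient moment the junk value of the inverse would force `lam ≤ 0`
    have hG : 0 < gradMoment T μ μ := by
      refine (gradMoment_nonneg T μ μ).lt_of_ne' fun h => ?_
      rw [h] at h1
      simp only [mul_zero, inv_zero] at h1
      linarith
    rw [← div_eq_mul_inv, le_div_iff₀ (by positivity)] at h1
    rw [CSGLD2, div_pow]
    field_simp
    linarith
  have t5 : γ * (Real.sqrt (18 * d) + Real.sqrt (132 * ‖μ‖ ^ 2)) ≤ 3 / 8 * δ := by
    have hQ : 0 < Real.sqrt (18 * d + 132 * ‖μ‖ ^ 2) := by positivity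
    have h1 := (hγ.le).trans (min_le_left _ _)
    rw [le_div_iff₀ (by positivity)] at h1
    set a := Real.sqrt (18 * d)
    set b := Real.sqrt (132 * ‖μ‖ ^ 2)
    set Q := Real.sqrt (18 * d + 132 * ‖μ‖ ^ 2)
    have ea : a ^ 2 = 18 * d := Real.sq_sqrt (by positivity)
    have eb : b ^ 2 = 132 * ‖μ‖ ^ 2 := Real.sq_sqrt (by positivity)
    have eQ : Q ^ 2 = 18 * d + 132 * ‖μ‖ ^ 2 := Real.sq_sqrt (by positivity)
    have h2 : a + b ≤ 3 / 2 * Q := by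
      apply le_of_sq_le_sq _ (by positivity)
      nlinarith [sq_nonneg (a - b), sq_nonneg a, sq_nonneg b]
    nlinarith [mul_le_mul_of_nonneg_left h2 hγ0.le]
  have t6 : c0 * (Real.exp (-(n * lam * moment2 T)) * Real.sqrt v +
      Real.sqrt (d * CSGLD1 T / β) + Real.sqrt (lam * CSGLD2 T μ μ)) ≤ δ / 4 := by
    calc _ ≤ c0 * (δ / (12 * c0) + δ / (12 * c0) + δ / (12 * c0)) := by gcongr
      _ = δ / 4 := by field_simp; ring
  linarith

end ScoreDiffusion

theorem mainTheorem1 {d : ℕ} (hd : 1 ≤ d) (μ : E d)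
    -- time horizon `T = (K + 1) γ` and stepsize `γ`
    (T γ : ℝ) (K : ℕ) (hγ0 : 0 < γ) (hγ1 : γ < 1) (hT : T = (K + 1) * γ)
    -- `θ*` is a minimiser of the score-matching objective
    (θstar : E d) (hθstar : IsMinOn (objective T μ) Set.univ θstar)
    -- parameters of SGLD
    (lam β : ℝ) (n : ℕ) (hlam0 : 0 < lam) (hlam : lam ≤ lamMax T) (hβ : 0 < β)
    -- the random inputs of SGLD
    {Ω₁ : Type*} [MeasurableSpace Ω₁] (P₁ : Measure Ω₁) [IsProbabilityMeasure P₁]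
    (θ₀ : Ω₁ → E d) (ξ : ℕ → Ω₁ → E d) (X : ℕ → Ω₁ → ℝ × E d × E d)
    (hθ₀_meas : Measurable θ₀) (hξ_meas : ∀ i, Measurable (ξ i)) (hX_meas : ∀ i, Measurable (X i))
    (hθ₀ : MemLp θ₀ 2 P₁)
    (hξ_law : ∀ i, HasLaw (ξ i) (stdGaussian (E d)) P₁) (hξ_indep : iIndepFun ξ P₁)
    (hX_law : ∀ i, HasLaw (X i) (sampleLaw T μ) P₁) (hX_indep : iIndepFun X P₁)
    (h_indep₀ : IndepFun θ₀ (fun ω => (fun i => ξ i ω, fun i => X i ω)) P₁)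
    (h_indep : IndepFun (fun ω i => ξ i ω) (fun ω i => X i ω) P₁)
    -- the random inputs of the Euler-Maruyama scheme
    {Ω₂ : Type*} [MeasurableSpace Ω₂] (P₂ : Measure Ω₂) [IsProbabilityMeasure P₂]
    (Y₀ : Ω₂ → E d) (Z : ℕ → Ω₂ → E d)
    (hY₀_meas : Measurable Y₀) (hZ_meas : ∀ k, Measurable (Z k))
    (hY₀_law : HasLaw Y₀ (stdGaussian (E d)) P₂)
    (hZ_law : ∀ k, HasLaw (Z k) (stdGaussian (E d)) P₂) (hZ_indep : iIndepFun Z P₂)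
    (hY₀_indep : IndepFun Y₀ (fun ω k => Z k ω) P₂)
    -- the law of the output of the diffusion model with `θ̂` the `n`-th iterate of SGLD
    (outputLaw : Measure (E d))
    (h_output : outputLaw = (P₁.prod P₂).map (fun ω =>
      eulerMaruyama γ T (sgld lam β (θ₀ ω.1) (fun i => ξ i ω.1) (fun i => X i ω.1) n)
        (Y₀ ω.2) (fun k => Z k ω.2) (K + 1))) :
    W2 outputLaw (dataLaw μ) ≤ ENNReal.ofReal (
        2 * Real.exp (-T) * (Real.sqrt (dataSecondMoment μ) + Real.sqrt (3 * d / 2)) +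
        (Real.sqrt (4 / 3) + 2 * Real.sqrt 33) *
          (Real.exp (-(n * lam * moment2 T)) * Real.sqrt (∫ ω, ‖θ₀ ω - θstar‖ ^ 2 ∂P₁) +
            Real.sqrt (d * CSGLD1 T / β) + Real.sqrt (lam * CSGLD2 T μ θstar)) +
        γ * (Real.sqrt (18 * d) + Real.sqrt (132 * ‖θstar‖ ^ 2))) ∧
    ∀ δ : ℝ, 0 < δ → Tdelta μ δ < T → betaDelta d T δ ≤ β → lam ≤ lamDelta T μ θstar δ →
      nDelta T lam (∫ ω, ‖θ₀ ω - θstar‖ ^ 2 ∂P₁) δ ≤ n → γ < gammaDelta θstar δ →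
      W2 outputLaw (dataLaw μ) < ENNReal.ofReal δ := by
  have hT0 : 0 < T := by rw [hT]; positivity
  obtain rfl : θstar = μ := eq_of_isMinOn_objective hT0 hθstar
  have ha := moment2_pos_of_lt_lamMax hlam0 hlam
  have hG := gradMoment_nonneg T θstar θstar
  obtain ⟨hL, herr⟩ := sgld_memLp_and_error_le hT0 θstar hθ₀_meas hξ_meas hX_meas hθ₀ hξ_law
    hξ_indep hX_law hX_indep h_indep₀ h_indep hlam0 hlam hβ n
  have hmeas : Measurable fun ω => sgld lam β (θ₀ ω) (fun i => ξ i ω) (fun i => X i ω) n :=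
    (measurable_sgld lam β n).comp (hθ₀_meas.prodMk
      ((measurable_pi_lambda _ hξ_meas).prodMk (measurable_pi_lambda _ hX_meas)))
  have hW := W2_eulerMaruyama_le θstar hγ0 hγ1 hT hmeas hL hY₀_meas hZ_meas hY₀_law hZ_law
    hZ_indep hY₀_indep
  rw [← h_output] at hW
  set v := ∫ ω, ‖θ₀ ω - θstar‖ ^ 2 ∂P₁
  have hv : 0 ≤ v := integral_nonneg fun ω => by positivity
  have hbound : W2 outputLaw (dataLaw θstar) ≤ ENNReal.ofReal (
      2 * Real.exp (-T) * (Real.sqrt (dataSecondMoment θstar) + Real.sqrt (3 * d / 2)) +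
      (Real.sqrt (4 / 3) + 2 * Real.sqrt 33) *
        (Real.exp (-(n * lam * moment2 T)) * Real.sqrt v +
          Real.sqrt (d * CSGLD1 T / β) + Real.sqrt (lam * CSGLD2 T θstar θstar)) +
      γ * (Real.sqrt (18 * d) + Real.sqrt (132 * ‖θstar‖ ^ 2))) := by
    refine hW.trans (ENNReal.ofReal_le_ofReal ?_)
    have h1 : Real.sqrt (∫ ω, ‖sgld lam β (θ₀ ω) (fun i => ξ i ω) (fun i => X i ω) n - θstar‖ ^ 2
        ∂P₁) ≤ Real.exp (-(n * lam * moment2 T)) * Real.sqrt v +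
          Real.sqrt (d * CSGLD1 T / β) + Real.sqrt (lam * CSGLD2 T θstar θstar) := by
      have p1 : 0 ≤ d * CSGLD1 T / β := by unfold CSGLD1; positivity
      have p2 : 0 ≤ lam * CSGLD2 T θstar θstar := by unfold CSGLD2; positivity
      apply Real.sqrt_le_iff.2 ⟨by positivity, herr.trans ?_⟩
      have e1 : Real.exp (-(2 * (n * lam * moment2 T))) =
          Real.exp (-(n * lam * moment2 T)) ^ 2 := by
        rw [← Real.exp_nat_mul]; push_cast; ring_nf
      have q0 : Real.exp (-(2 * (n * lam * moment2 T))) * v =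
          (Real.exp (-(n * lam * moment2 T)) * Real.sqrt v) ^ 2 := by
        rw [mul_pow, Real.sq_sqrt hv, e1]
      have q1 := Real.sq_sqrt p1
      have q2 := Real.sq_sqrt p2
      have r0 : 0 ≤ Real.exp (-(n * lam * moment2 T)) * Real.sqrt v := by positivity
      have r1 := Real.sqrt_nonneg (d * CSGLD1 T / β)
      have r2 := Real.sqrt_nonneg (lam * CSGLD2 T θstar θstar)
      nlinarith [mul_nonneg r0 r1, mul_nonneg r0 r2, mul_nonneg r1 r2]
    set R := Real.exp (-(n * lam * moment2 T)) * Real.sqrt v +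
      Real.sqrt (d * CSGLD1 T / β) + Real.sqrt (lam * CSGLD2 T θstar θstar)
    have hR : 0 ≤ R := by positivity
    have h2 : R ≤ (Real.sqrt (4 / 3) + 2 * Real.sqrt 33) * R :=
      le_mul_of_one_le_left hR one_le_c0
    have h3 : Real.exp (-T) * ‖θstar‖ ≤
        2 * Real.exp (-T) * (Real.sqrt (dataSecondMoment θstar) + Real.sqrt (3 * d / 2)) := by
      have h := norm_le_sqrt_dataSecondMoment θstar
      have h' := Real.sqrt_nonneg (3 * d / 2 : ℝ)
      have := Real.exp_pos (-T)
      nlinarith [norm_nonneg θstar]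
    have h4 : γ * Real.sqrt d ≤ γ * Real.sqrt (18 * d) := by
      gcongr
      linarith [Nat.cast_nonneg (α := ℝ) d]
    have h5 : γ * ‖θstar‖ ≤ γ * Real.sqrt (132 * ‖θstar‖ ^ 2) := by
      gcongr
      exact Real.le_sqrt_of_sq_le (by nlinarith [sq_nonneg ‖θstar‖])
    linarith
  refine ⟨hbound, fun δ hδ hTδ hβδ hlamδ hnδ hγδ => hbound.trans_lt ?_⟩
  exact (ENNReal.ofReal_lt_ofReal_iff hδ).2
    (error_bound_lt hd θstar hγ0 hlam0 ha hβ hv hδ hTδ hβδ hlamδ hnδ hγδ)
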